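/- Let $d_1,d_2,n_0\ge 1$ be integers and let $d$ be an integer with $d\ge\max(d_1,d_2)$ (for instance $d=\max(d_1,d_2)$ or $d=d_1+d_2$). Let $\mathcal A\subseteq\mathbb R^{d_1\times d_2}$, and let $\pi$ be a probability distribution on $\mathbb R^{d_1\times d_2}$ that is supported on $\mathcal A$ and has a finite second moment (automatic if $\mathcal A$ is bounded). Write $\langle A,C\rangle=\mathrm{tr}(A^\top C)$, let $\mathrm{vec}$ denote column-stacking vectorization and $\mathrm{reshape}$ its inverse, and put $Q=Q(\pi)=\mathbb E_{A\sim\pi}[\mathrm{vec}(A)\mathrm{vec}(A)^\top]$, which is assumed to be invertible. Index the coordinates of $\mathbb R^{d_1d_2}$ by the matrix positions $(i,j)$, with row $i\in\{1,\dots,d_1\}$ and column $j\in\{1,\dots,d_2\}$. Let $D^{(\mathrm{col})}_j\in\mathbb R^{d_1\times d_1}$ be the principal submatrix of $Q^{-1}$ on the positions in column $j$, let $D^{(\mathrm{row})}_i\in\mathbb R^{d_2\times d_2}$ be the principal submatrix of $Q^{-1}$ on the positions in row $i$, and set $$B(Q)=\max\Big(\lambda_{\max}\Big(\sum_{j=1}^{d_2}D^{(\mathrm{col})}_j\Big),\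 \lambda_{\max}\Big(\sum_{i=1}^{d_1}D^{(\mathrm{row})}_i\Big)\Big).$$ Let $\Theta^*,\Theta_0\in\mathbb R^{d_1\times d_2}$ be fixed (non-random), and let $\sigma\ge 0$ and $R_0$ be reals, $\sigma$ and $R_0$ not both $0$, with $|\langle\Theta_0-\Theta^*,A\rangle|\le R_0$ for all $A\in\mathcal A$. Let $\delta\in(0,1)$. Let $(X_k,\eta_k)$, $k=1,\dots,n_0$, be independent pairs of random variables with $X_k\sim\pi$ and such that $\eta_k$ is zero-mean $\sigma$-sub-Gaussian given $X_k$, that is, $\mathbb E[e^{s\eta_k}\mid X_k]\le e^{\sigma^2s^2/2}$ almost surely for every $s\in\mathbb R$ (with $\mathbb E\,e^{s\eta_k}<\infty$). Let $Y_k=\langle\Theta^*,X_k\rangle+\eta_k$. Define the one-sample estimates $$M_k=\mathrm{reshape}\big(Q^{-1}(Y_k-\langle\Theta_0,X_k\rangle)\,\mathrm{vec}(X_k)\big),$$ the influence function $\phi(x)=\ln(1+x+x^2/2)$ for $x\ge0$ and $\phi(x)=-\ln(1-x+x^2/2)$ for $x<0$, applied to symmetric matrices through the spectral calculus, the dilation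 $\mathcal H(A)=\begin{pmatrix}0&A\\A^\top&0\end{pmatrix}$, and $$\nu=\sqrt{\frac{\ln(2d/\delta)}{(\sigma^2+R_0^2)\,B(Q)\,n_0}},\qquad \Theta_1=\Theta_0+\frac1{n_0\nu}\Big(\sum_{k=1}^{n_0}\phi\big(\nu\,\mathcal H(M_k)\big)\Big)_{\mathsf{ht}},$$ where $(\cdot)_{\mathsf{ht}}$ is the upper right $d_1\times d_2$ block. Then, with probability at least $1-\delta$, $$\|\Theta_1-\Theta^*\|_{\mathrm{op}}\le 2\sqrt{\frac{(\sigma^2+R_0^2)\,B(Q)\,\ln(2d/\delta)}{n_0}}.$$ Moreover, the matrices $M_kM_k^\top$ and $M_k^\top M_k$ are integrable, and $$\max\Big(\sum_{k=1}^{n_0}\big\|\mathbb E[M_kM_k^\top]\big\|_{\mathrm{op}},\ \sum_{k=1}^{n_0}\big\|\mathbb E[M_k^\top M_k]\big\|_{\mathrm{op}}\Big)\le 2n_0\,B(Q)\,(\sigma^2+R_0^2).$$ -/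

import Mathlib

open MeasureTheory ProbabilityTheory Matrix
open scoped Matrix.Norms.L2Operator

-- `‖A‖` for a real matrix `A` is the Euclidean operator norm (largest singular value).

/-- The Borel σ-algebra on a space of real matrices (the product of the Borel σ-algebras of the
entries). -/
instance matrixMeasurableSpace (m n : Type) : MeasurableSpace (Matrix m n ℝ) :=
  inferInstanceAs (MeasurableSpace (m → n → ℝ))

namespace LowRankDesign

/-- The entrywise (trace) inner product `⟨A, B⟩ = tr(Aᵀ B)` of matrices. -/
def matInner {d₁ d₂ : ℕ} (A B : Matrix (Fin d₁) (Fin d₂) ℝ) : ℝ := (Aᵀ * B).trace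

/-- The inverse of column-stacking vectorization `Matrix.vec`, where `vec A (j, i) = A i j`. -/
def reshape {d₁ d₂ : ℕ} (v : Fin d₂ × Fin d₁ → ℝ) : Matrix (Fin d₁) (Fin d₂) ℝ :=
  Matrix.of fun i j => v (j, i)

/-- `Q(π) = 𝔼_{A ∼ π} [vec(A) vec(A)ᵀ]`. -/
noncomputable def designCov {d₁ d₂ : ℕ} (π : Measure (Matrix (Fin d₁) (Fin d₂) ℝ)) :
    Matrix (Fin d₂ × Fin d₁) (Fin d₂ × Fin d₁) ℝ :=
  Matrix.of fun p q => ∫ A, A.vec p * A.vec q ∂π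

/-- `D_j^(col)`: the diagonal `d₁ × d₁` block of `Q⁻¹` that belongs to column `j`. -/
noncomputable def Dcol {d₁ d₂ : ℕ} (Q : Matrix (Fin d₂ × Fin d₁) (Fin d₂ × Fin d₁) ℝ)
    (j : Fin d₂) : Matrix (Fin d₁) (Fin d₁) ℝ :=
  Q⁻¹.submatrix (fun i => (j, i)) (fun i => (j, i))

/-- `D_i^(row)`: the `d₂ × d₂` principal submatrix of `Q⁻¹` that belongs to row `i`. -/
noncomputable def Drow {d₁ d₂ : ℕ} (Q : Matrix (Fin d₂ × Fin d₁) (Fin d₂ × Fin d₁) ℝ)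
    (i : Fin d₁) : Matrix (Fin d₂) (Fin d₂) ℝ :=
  Q⁻¹.submatrix (fun j => (j, i)) (fun j => (j, i))

/-- Largest eigenvalue of a real symmetric matrix. -/
noncomputable def lambdaMax {n : ℕ} (A : Matrix (Fin n) (Fin n) ℝ) : ℝ :=
  sSup (spectrum ℝ A)

/-- `B(Q) = max(λ_max(∑_j D_j^(col)), λ_max(∑_i D_i^(row)))`. -/
noncomputable def B {d₁ d₂ : ℕ} (Q : Matrix (Fin d₂ × Fin d₁) (Fin d₂ × Fin d₁) ℝ) : ℝ :=
  max (lambdaMax (∑ j, Dcol Q j)) (lambdaMax (∑ i, Drow Q i))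

/-- Minsker's influence function. -/
noncomputable def phi (x : ℝ) : ℝ :=
  if 0 ≤ x then Real.log (1 + x + x ^ 2 / 2) else -Real.log (1 - x + x ^ 2 / 2)

/-- The Hermitian dilation of `A`, the symmetric block matrix `[[0, A], [Aᵀ, 0]]`. -/
def dilation {d₁ d₂ : ℕ} (A : Matrix (Fin d₁) (Fin d₂) ℝ) :
    Matrix (Fin d₁ ⊕ Fin d₂) (Fin d₁ ⊕ Fin d₂) ℝ :=
  Matrix.fromBlocks 0 A Aᵀ 0

/-- Minsker's robust matrix mean `(1/(nν)) (∑ₖ φ(ν H(Mₖ)))_ht`: `φ` acts on symmetric matrices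
through the spectral calculus, and `(·)_ht` is the upper right `d₁ × d₂` block. -/
noncomputable def robustMean {d₁ d₂ n : ℕ} (ν : ℝ) (M : Fin n → Matrix (Fin d₁) (Fin d₂) ℝ) :
    Matrix (Fin d₁) (Fin d₂) ℝ :=
  (1 / (n * ν)) • (∑ k, cfc phi (ν • dilation (M k))).toBlocks₁₂

/-- The one-sample estimate `reshape(Q⁻¹ (y - ⟨Θ₀, A⟩) vec(A))` of `Θ* - Θ₀`. -/
noncomputable def oneSample {d₁ d₂ : ℕ} (Q : Matrix (Fin d₂ × Fin d₁) (Fin d₂ × Fin d₁) ℝ)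
    (Θ₀ A : Matrix (Fin d₁) (Fin d₂) ℝ) (y : ℝ) : Matrix (Fin d₁) (Fin d₂) ℝ :=
  reshape (Q⁻¹ *ᵥ ((y - matInner Θ₀ A) • A.vec))

/-- The tuning parameter `ν = √(ln(2d/δ) / ((σ² + R₀²) B(Q) n₀))`. -/
noncomputable def tuning {d₁ d₂ : ℕ} (Q : Matrix (Fin d₂ × Fin d₁) (Fin d₂ × Fin d₁) ℝ)
    (σ R₀ δ : ℝ) (d n₀ : ℕ) : ℝ :=
  √(Real.log (2 * d / δ) / ((σ ^ 2 + R₀ ^ 2) * B Q * n₀))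

/-- The pilot estimator `Θ₁` computed from the samples `(X k, Y k)`, `k < n₀`. -/
noncomputable def pilot {d₁ d₂ n₀ : ℕ} (Q : Matrix (Fin d₂ × Fin d₁) (Fin d₂ × Fin d₁) ℝ)
    (Θ₀ : Matrix (Fin d₁) (Fin d₂) ℝ) (σ R₀ δ : ℝ) (d : ℕ)
    (X : Fin n₀ → Matrix (Fin d₁) (Fin d₂) ℝ) (Y : Fin n₀ → ℝ) : Matrix (Fin d₁) (Fin d₂) ℝ :=
  Θ₀ + robustMean (tuning Q σ R₀ δ d n₀) fun k => oneSample Q Θ₀ (X k) (Y k)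

/-- Given `X`, the real random variable `η` is (zero-mean) `σ`-sub-Gaussian:
`𝔼[exp(s η) | X] ≤ exp(σ² s² / 2)` almost surely, for every real `s`. -/
def CondSubgaussian {Ω E : Type*} [MeasurableSpace Ω] [MeasurableSpace E] (μ : Measure Ω)
    (η : Ω → ℝ) (X : Ω → E) (σ : ℝ) : Prop :=
  ∀ s : ℝ, Integrable (fun ω => Real.exp (s * η ω)) μ ∧
    μ[fun ω => Real.exp (s * η ω) | MeasurableSpace.comap X inferInstance]
      ≤ᵐ[μ] fun _ => Real.exp (σ ^ 2 * s ^ 2 / 2)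

end LowRankDesign

/-!
The estimate `Θ₁ - Θ₀` is a robust mean of independent one-sample estimates
`Mₖ = (⟨Θ* - Θ₀, Xₖ⟩ + ηₖ) Nₖ` with `Nₖ = reshape (Q⁻¹ vec Xₖ)`. Whitening by `Q⁻¹` makes each of
them unbiased, `𝔼 Mₖ = Θ* - Θ₀`, and gives `𝔼[N Nᵀ] = ∑ D_j^(col)`, `𝔼[Nᵀ N] = ∑ D_i^(row)`.
Expanding the conditional moment generating function of the noise at `0` shows `𝔼[η | X] = 0` and
`𝔼[η² | X] ≤ σ²`, so with `(a + η)² ≤ 2 a² + 2 η²` both second moments of `Mₖ` are at most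
`v = 2 (σ² + R₀²) B(Q)` in the Loewner order (`integral_residual_sq_smul_le`). This is the bound on
the variance proxy.

The error bound is Minsker's deviation inequality `measure_norm_robustMean_sub_gt_le`. Since
`φ x ≤ log (1 + x + x² / 2)`, a summand `φ(ν H)` of the robust mean (`H` the dilation of a sample)
is at most `log T` with `T = 1 + ν H + ν² H² / 2 ≥ 1 / 2`. By Lieb's theorem (`lieb_concave`),
`T ↦ tr exp (K + log T)` is concave, so Jensen's inequality moves the expectation inside, and
`log x ≤ x - 1` leaves `tr exp (K + ν 𝔼 H + ν² v / 2)` (`lintegral_trexp_add_phi_le`). Independence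
allows this for one summand after the other (`lintegral_trexp_sum_le`), and Markov's inequality for
the trace exponential bounds the largest eigenvalue of `∑ φ(ν Hₖ) - n ν 𝔼 H`. This matrix is itself
a dilation because `φ` is odd, hence its largest eigenvalue is the norm of its upper right block,
and a one-sided bound suffices: the dimension factor is `d₁ + d₂ ≤ 2 d`.

Lieb's theorem follows from Gibbs' variational formula
`tr exp (K + log T) = max_S (tr (S K) - D(S; T) + tr T)` and the joint convexity of the relative
entropy `D` (`relEntropy_convex`). The latter holds because `D(A; B)` is an integral over
`t ∈ [0, 1]` of quadratic forms of `(t L_A + (1 - t) R_B)⁻¹` at `A - B`, where `L_A` and `R_B` are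
left and right multiplication, and each of these forms is a supremum of functions that are linear
in `(A, B)`.
-/

/-! ### Trace inequalities from double spectral sums -/

namespace LowRankDesign

section TraceInequalities

open scoped MatrixOrder

variable {n : Type*} [Fintype n] [DecidableEq n] {A B : Matrix n n ℝ}

/-- The matrix of inner products between the eigenbases of two symmetric matrices. -/
noncomputable def overlap (hA : A.IsHermitian) (hB : B.IsHermitian) : Matrix n n ℝ :=
  (hA.eigenvectorUnitary : Matrix n n ℝ)ᵀ * (hB.eigenvectorUnitary : Matrix n n ℝ)

lemma transpose_eigenvectorUnitary_mul (hA : A.IsHermitian) :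
    (hA.eigenvectorUnitary : Matrix n n ℝ)ᵀ * (hA.eigenvectorUnitary : Matrix n n ℝ) = 1 := by
  rw [← conjTranspose_eq_transpose_of_trivial]
  exact Unitary.coe_star_mul_self hA.eigenvectorUnitary

lemma eigenvectorUnitary_mul_transpose (hA : A.IsHermitian) :
    (hA.eigenvectorUnitary : Matrix n n ℝ) * (hA.eigenvectorUnitary : Matrix n n ℝ)ᵀ = 1 := by
  rw [← conjTranspose_eq_transpose_of_trivial]
  exact Unitary.coe_mul_star_self hA.eigenvectorUnitary

lemma cfc_eq_conj_diagonal (hA : A.IsHermitian) (f : ℝ → ℝ) :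
    cfc f A = (hA.eigenvectorUnitary : Matrix n n ℝ) * diagonal (fun i => f (hA.eigenvalues i)) *
      (hA.eigenvectorUnitary : Matrix n n ℝ)ᵀ := by
  rw [hA.cfc_eq, Matrix.IsHermitian.cfc, Unitary.conjStarAlgAut_apply, star_eq_conjTranspose,
    conjTranspose_eq_transpose_of_trivial]
  rfl

lemma eq_conj_diagonal (hA : A.IsHermitian) :
    A = (hA.eigenvectorUnitary : Matrix n n ℝ) * diagonal hA.eigenvalues *
      (hA.eigenvectorUnitary : Matrix n n ℝ)ᵀ := by
  conv_lhs => rw [← cfc_id ℝ A hA.isSelfAdjoint, cfc_eq_conj_diagonal hA]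
  rfl

/-- The double spectral sum that reduces trace inequalities in two symmetric matrices to scalar
inequalities between their eigenvalues. -/
lemma trace_cfc_mul_cfc (hA : A.IsHermitian) (hB : B.IsHermitian) (f g : ℝ → ℝ) :
    (cfc f A * cfc g B).trace =
      ∑ i, ∑ j, f (hA.eigenvalues i) * g (hB.eigenvalues j) * overlap hA hB i j ^ 2 := by
  set U : Matrix n n ℝ := (hA.eigenvectorUnitary : Matrix n n ℝ) with hU
  set V : Matrix n n ℝ := (hB.eigenvectorUnitary : Matrix n n ℝ) with hV
  have h1 : (cfc f A * cfc g B).trace =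
      (diagonal (fun i => f (hA.eigenvalues i)) * (Uᵀ * V) *
        (diagonal (fun i => g (hB.eigenvalues i)) * (Uᵀ * V)ᵀ)).trace := by
    rw [cfc_eq_conj_diagonal hA, cfc_eq_conj_diagonal hB, ← hU, ← hV, transpose_mul,
      transpose_transpose]
    simp only [Matrix.mul_assoc]
    rw [trace_mul_comm]
    simp only [Matrix.mul_assoc]
  rw [h1, trace]
  refine Finset.sum_congr rfl fun i _ => ?_
  rw [diag_apply, mul_apply]
  refine Finset.sum_congr rfl fun j _ => ?_
  rw [diagonal_mul, diagonal_mul, transpose_apply, overlap]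
  ring

lemma trace_cfc_left (hA : A.IsHermitian) (hB : B.IsHermitian) (f : ℝ → ℝ) :
    (cfc f A).trace = ∑ i, ∑ j, f (hA.eigenvalues i) * overlap hA hB i j ^ 2 := by
  have := trace_cfc_mul_cfc hA hB f (fun _ => 1)
  rw [cfc_const_one ℝ B hB.isSelfAdjoint, mul_one] at this
  simpa using this

lemma trace_cfc_right (hA : A.IsHermitian) (hB : B.IsHermitian) (g : ℝ → ℝ) :
    (cfc g B).trace = ∑ i, ∑ j, g (hB.eigenvalues j) * overlap hA hB i j ^ 2 := by
  have := trace_cfc_mul_cfc hA hB (fun _ => 1) g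
  rw [cfc_const_one ℝ A hA.isSelfAdjoint, one_mul] at this
  simpa using this

lemma trace_cfc_eq_sum (hA : A.IsHermitian) (f : ℝ → ℝ) :
    (cfc f A).trace = ∑ i, f (hA.eigenvalues i) := by
  rw [cfc_eq_conj_diagonal hA, trace_mul_comm, ← Matrix.mul_assoc,
    transpose_eigenvectorUnitary_mul, Matrix.one_mul, trace_diagonal]

/-- The trace of the matrix exponential. -/
noncomputable def trexp (A : Matrix n n ℝ) : ℝ := (NormedSpace.exp A).trace

lemma trexp_eq_trace_cfc (hA : A.IsHermitian) : trexp A = (cfc Real.exp A).trace := by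
  rw [CFC.real_exp_eq_normedSpace_exp (a := A) hA.isSelfAdjoint, trexp]

lemma trexp_eq_sum (hA : A.IsHermitian) : trexp A = ∑ i, Real.exp (hA.eigenvalues i) := by
  rw [trexp_eq_trace_cfc hA, trace_cfc_eq_sum hA]

lemma continuous_trexp : Continuous (trexp : Matrix n n ℝ → ℝ) := by
  let _ : NormedAlgebra ℚ (Matrix n n ℝ) := NormedAlgebra.restrictScalars ℚ ℝ _
  exact NormedSpace.exp_continuous.matrix_trace

lemma trexp_nonneg (hA : A.IsHermitian) : 0 ≤ trexp A := by
  rw [trexp_eq_sum hA]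
  positivity

/-- Klein's inequality in the form of Gibbs' variational principle: among positive definite `A`, the
functional `tr (A B) - tr (A log A) + tr A` is at most `tr (exp B)`. -/
lemma klein (hA : A.PosDef) (hB : B.IsHermitian) :
    (A * B).trace - (cfc (fun x => x * Real.log x) A).trace + A.trace ≤ trexp B := by
  have hA' := hA.isHermitian
  have e1 : (A * B).trace = (cfc (fun x : ℝ => x) A * cfc (fun x : ℝ => x) B).trace := by
    rw [cfc_id' ℝ A hA'.isSelfAdjoint, cfc_id' ℝ B hB.isSelfAdjoint]
  have e2 : A.trace = (cfc (fun x : ℝ => x) A).trace := by rw [cfc_id' ℝ A hA'.isSelfAdjoint]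
  rw [trexp_eq_trace_cfc hB, e1, e2, trace_cfc_mul_cfc hA' hB, trace_cfc_left hA' hB,
    trace_cfc_left hA' hB, trace_cfc_right hA' hB, ← Finset.sum_sub_distrib,
    ← Finset.sum_add_distrib]
  refine Finset.sum_le_sum fun i _ => ?_
  rw [← Finset.sum_sub_distrib, ← Finset.sum_add_distrib]
  refine Finset.sum_le_sum fun j _ => ?_
  rw [← sub_mul, ← add_mul]
  refine mul_le_mul_of_nonneg_right ?_ (sq_nonneg _)
  set a := hA'.eigenvalues i
  set b := hB.eigenvalues j
  have ha : 0 < a := hA.eigenvalues_pos i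
  have h := Real.add_one_le_exp (b - Real.log a)
  rw [Real.exp_sub, Real.exp_log ha, le_div_iff₀ ha] at h
  linarith

lemma posDef_cfc_exp (hA : A.IsHermitian) : (cfc Real.exp A).PosDef := by
  rw [cfc_eq_conj_diagonal hA, ← conjTranspose_eq_transpose_of_trivial, ← star_eq_conjTranspose,
    Matrix.IsUnit.posDef_star_right_conjugate_iff
      (IsUnit.of_mul_eq_one _ (eigenvectorUnitary_mul_transpose hA)),
    posDef_diagonal_iff]
  exact fun i => Real.exp_pos _

/-- The case of equality in Gibbs' variational principle. -/
lemma klein_exp (hB : B.IsHermitian) :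
    (cfc Real.exp B * B).trace - (cfc (fun x => x * Real.log x) (cfc Real.exp B)).trace +
      (cfc Real.exp B).trace = trexp B := by
  have h : cfc (fun x => x * Real.log x) (cfc Real.exp B) = cfc Real.exp B * B := by
    rw [← cfc_comp' (fun x => x * Real.log x) Real.exp B
      (ha := hB.isSelfAdjoint) 
      (hg := (finite_real_spectrum.image _).continuousOn _)]
    conv_rhs => rw [← cfc_id' ℝ B hB.isSelfAdjoint]
    simp only [Real.log_exp]
    rw [cfc_id' ℝ B hB.isSelfAdjoint, cfc_mul Real.exp (fun x => x) B, cfc_id' ℝ B hB.isSelfAdjoint]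
  rw [h, trexp_eq_trace_cfc hB]
  ring

lemma trace_mul_nonneg_of_posSemidef (hA : A.PosSemidef) (hB : B.PosSemidef) :
    0 ≤ (A * B).trace := by
  have e1 : (A * B).trace = (cfc (fun x : ℝ => x) A * cfc (fun x : ℝ => x) B).trace := by
    rw [cfc_id' ℝ A hA.isHermitian.isSelfAdjoint, cfc_id' ℝ B hB.isHermitian.isSelfAdjoint]
  rw [e1, trace_cfc_mul_cfc hA.isHermitian hB.isHermitian.isSelfAdjoint]
  have h1 := hA.eigenvalues_nonneg
  have h2 := hB.eigenvalues_nonneg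
  exact Finset.sum_nonneg fun i _ => Finset.sum_nonneg fun j _ =>
    mul_nonneg (mul_nonneg (h1 i) (h2 j)) (sq_nonneg _)

lemma trexp_mono (hA : A.IsHermitian) (hB : B.IsHermitian) (hAB : A ≤ B) : trexp A ≤ trexp B := by
  have h1 := klein (posDef_cfc_exp hA) hB
  have h2 := klein_exp hA
  have h3 := trace_mul_nonneg_of_posSemidef (posDef_cfc_exp hA).posSemidef (le_iff.1 hAB)
  rw [Matrix.mul_sub, trace_sub] at h3
  linarith

end TraceInequalities

/-! ### Joint convexity of the relative entropy and Lieb's theorem -/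

section Lieb

variable {n : Type*} [Fintype n] [DecidableEq n] {A B : Matrix n n ℝ}

/-- The Umegaki relative entropy `tr (A log A - A log B - A + B)` of positive definite matrices. -/
noncomputable def relEntropy (A B : Matrix n n ℝ) : ℝ :=
  (cfc (fun x => x * Real.log x) A).trace - (A * cfc Real.log B).trace - A.trace + B.trace

/-- Second-order Taylor formula for `x log x` between `b` and `a`. -/
lemma scalar_relEntropy_eq_integral {a b : ℝ} (ha : 0 < a) (hb : 0 < b) :
    ∫ t in (0 : ℝ)..1, (1 - t) * ((a - b) ^ 2 / (t * a + (1 - t) * b)) =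
      a * Real.log a - a * Real.log b - a + b := by
  have hpos : ∀ t ∈ Set.uIcc (0 : ℝ) 1, 0 < t * a + (1 - t) * b := by
    intro t ht
    rw [Set.uIcc_of_le zero_le_one] at ht
    rcases ht.1.eq_or_lt with h | h
    · simp [← h, hb]
    · have := mul_pos h ha
      have := mul_nonneg (sub_nonneg.2 ht.2) hb.le
      linarith
  have hderiv : ∀ t ∈ Set.uIcc (0 : ℝ) 1, HasDerivAt
      (fun t => (1 - t) * (a - b) * Real.log (t * a + (1 - t) * b) +
        ((t * a + (1 - t) * b) * Real.log (t * a + (1 - t) * b) - (t * a + (1 - t) * b)))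
      ((1 - t) * ((a - b) ^ 2 / (t * a + (1 - t) * b))) t := by
    intro t ht
    have hx := (hpos t ht).ne'
    have h1 : HasDerivAt (fun t : ℝ => t * a + (1 - t) * b) (a - b) t := by
      exact (((hasDerivAt_id t).mul_const a).add
        (((hasDerivAt_id t).const_sub 1).mul_const b)).congr_deriv (by ring)
    have h2 := h1.log hx
    have h3 : HasDerivAt (fun t : ℝ => (1 - t) * (a - b)) (-(a - b)) t := by
      exact (((hasDerivAt_id t).const_sub 1).mul_const (a - b)).congr_deriv (by ring)
    refine ((h3.mul h2).add ((h1.mul h2).sub h1)).congr_deriv ?_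
    have h4 := mul_div_cancel₀ (a - b) hx
    linear_combination h4
  rw [intervalIntegral.integral_eq_sub_of_hasDerivAt hderiv]
  · simp
    ring
  · refine ContinuousOn.intervalIntegrable ?_
    refine ContinuousOn.mul (by fun_prop) (ContinuousOn.div (by fun_prop) (by fun_prop) ?_)
    exact fun t ht => (hpos t ht).ne'

/-- The integrand at `t` in the integral representation of the relative entropy: the quadratic form
of the inverse of `X ↦ t A X + (1 - t) X B` at `A - B`. -/
noncomputable def resolventForm (hA : A.IsHermitian) (hB : B.IsHermitian) (t : ℝ) : ℝ :=
  ∑ i, ∑ j, (hA.eigenvalues i - hB.eigenvalues j) ^ 2 /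
    (t * hA.eigenvalues i + (1 - t) * hB.eigenvalues j) * overlap hA hB i j ^ 2

/-- The function of `W`, linear in `(A, B)`, whose supremum over `W` is the
resolvent form. -/
def resolventDual (t : ℝ) (A B W : Matrix n n ℝ) : ℝ :=
  2 * ((Wᵀ * A).trace - (Wᵀ * B).trace) - t * (Wᵀ * A * W).trace - (1 - t) * (Wᵀ * W * B).trace

/-- In the eigenbases of `A` and `B` the dual functional decouples into scalar quadratics. -/
lemma resolventDual_conj (hA : A.IsHermitian) (hB : B.IsHermitian) (t : ℝ) (Z : Matrix n n ℝ) :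
    resolventDual t A B ((hA.eigenvectorUnitary : Matrix n n ℝ) * Z *
        (hB.eigenvectorUnitary : Matrix n n ℝ)ᵀ) =
      ∑ i, ∑ j, (2 * Z i j * overlap hA hB i j * (hA.eigenvalues i - hB.eigenvalues j) -
        (t * hA.eigenvalues i + (1 - t) * hB.eigenvalues j) * Z i j ^ 2) := by
  set O := overlap hA hB with hO
  rw [overlap] at hO
  have hA1 := eq_conj_diagonal hA
  have hB1 := eq_conj_diagonal hB
  have hU := transpose_eigenvectorUnitary_mul hA
  have hV := transpose_eigenvectorUnitary_mul hB
  set U : Matrix n n ℝ := (hA.eigenvectorUnitary : Matrix n n ℝ)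
  set V : Matrix n n ℝ := (hB.eigenvectorUnitary : Matrix n n ℝ)
  set a := hA.eigenvalues
  set b := hB.eigenvalues
  have hU' : ∀ M : Matrix n n ℝ, Uᵀ * (U * M) = M := fun M => by
    rw [← Matrix.mul_assoc, hU, Matrix.one_mul]
  have hV' : ∀ M : Matrix n n ℝ, Vᵀ * (V * M) = M := fun M => by
    rw [← Matrix.mul_assoc, hV, Matrix.one_mul]
  have hO' : ∀ M : Matrix n n ℝ, Uᵀ * (V * M) = O * M := fun M => by
    rw [← Matrix.mul_assoc, hO]
  have e1 : ((U * Z * Vᵀ)ᵀ * A).trace = ∑ i, ∑ j, Z i j * O i j * a i := by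
    have : ((U * Z * Vᵀ)ᵀ * A).trace = (diagonal a * O * Zᵀ).trace := by
      rw [hA1]
      simp only [transpose_mul, transpose_transpose, Matrix.mul_assoc, hU']
      rw [trace_mul_comm]
      simp only [Matrix.mul_assoc, ← hO]
      rw [trace_mul_comm]
      simp only [Matrix.mul_assoc]
    rw [this, trace]
    refine Finset.sum_congr rfl fun i _ => ?_
    rw [diag_apply, mul_apply]
    refine Finset.sum_congr rfl fun j _ => ?_
    rw [diagonal_mul, transpose_apply]
    ring
  have e2 : ((U * Z * Vᵀ)ᵀ * B).trace = ∑ i, ∑ j, Z i j * O i j * b j := by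
    have : ((U * Z * Vᵀ)ᵀ * B).trace = (O * diagonal b * Zᵀ).trace := by
      rw [hB1]
      simp only [transpose_mul, transpose_transpose, Matrix.mul_assoc, hO']
      rw [trace_mul_comm]
      simp only [Matrix.mul_assoc, hV, Matrix.mul_one]
      rw [trace_mul_comm]
      simp only [Matrix.mul_assoc]
    rw [this, trace]
    refine Finset.sum_congr rfl fun i _ => ?_
    rw [diag_apply, mul_apply]
    refine Finset.sum_congr rfl fun j _ => ?_
    rw [mul_diagonal, transpose_apply]
    ring
  have e3 : ((U * Z * Vᵀ)ᵀ * A * (U * Z * Vᵀ)).trace = ∑ i, ∑ j, a i * Z i j ^ 2 := by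
    have : ((U * Z * Vᵀ)ᵀ * A * (U * Z * Vᵀ)).trace = (diagonal a * Z * Zᵀ).trace := by
      rw [hA1]
      simp only [transpose_mul, transpose_transpose, Matrix.mul_assoc, hU']
      rw [trace_mul_comm]
      simp only [Matrix.mul_assoc, hV, Matrix.mul_one]
      rw [trace_mul_comm]
      simp only [Matrix.mul_assoc]
    rw [this, trace]
    refine Finset.sum_congr rfl fun i _ => ?_
    rw [diag_apply, mul_apply]
    refine Finset.sum_congr rfl fun j _ => ?_
    rw [diagonal_mul, transpose_apply]
    ring
  have e4 : ((U * Z * Vᵀ)ᵀ * (U * Z * Vᵀ) * B).trace = ∑ i, ∑ j, b j * Z i j ^ 2 := by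
    have : ((U * Z * Vᵀ)ᵀ * (U * Z * Vᵀ) * B).trace = (Z * diagonal b * Zᵀ).trace := by
      rw [hB1]
      simp only [transpose_mul, transpose_transpose, Matrix.mul_assoc, hU', hV']
      rw [trace_mul_comm]
      simp only [Matrix.mul_assoc, hV, Matrix.mul_one]
      rw [trace_mul_comm]
      simp only [Matrix.mul_assoc]
    rw [this, trace]
    refine Finset.sum_congr rfl fun i _ => ?_
    rw [diag_apply, mul_apply]
    refine Finset.sum_congr rfl fun j _ => ?_
    rw [mul_diagonal, transpose_apply]
    ring
  rw [resolventDual, e1, e2, e3, e4]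
  simp only [Finset.mul_sum, ← Finset.sum_sub_distrib]
  refine Finset.sum_congr rfl fun i _ => Finset.sum_congr rfl fun j _ => ?_
  ring

lemma convex_comb_eigenvalues_pos (hA : A.PosDef) (hB : B.PosDef) {t : ℝ} (ht : t ∈ Set.Icc 0 1)
    (i j : n) : 0 < t * hA.isHermitian.eigenvalues i + (1 - t) * hB.isHermitian.eigenvalues j := by
  have ha := hA.eigenvalues_pos i
  have hb := hB.eigenvalues_pos j
  rcases ht.1.eq_or_lt with h | h
  · rw [← h]
    simpa using hb
  · have := mul_pos h ha
    have := mul_nonneg (sub_nonneg.2 ht.2) hb.le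
    linarith

lemma resolventDual_le (hA : A.PosDef) (hB : B.PosDef) {t : ℝ} (ht : t ∈ Set.Icc 0 1)
    (W : Matrix n n ℝ) :
    resolventDual t A B W ≤ resolventForm hA.isHermitian hB.isHermitian t := by
  have hW : W = (hA.isHermitian.eigenvectorUnitary : Matrix n n ℝ) *
      ((hA.isHermitian.eigenvectorUnitary : Matrix n n ℝ)ᵀ * W *
        (hB.isHermitian.eigenvectorUnitary : Matrix n n ℝ)) *
      (hB.isHermitian.eigenvectorUnitary : Matrix n n ℝ)ᵀ := by
    simp only [Matrix.mul_assoc, eigenvectorUnitary_mul_transpose, Matrix.mul_one]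
    rw [← Matrix.mul_assoc, eigenvectorUnitary_mul_transpose, Matrix.one_mul]
  rw [hW, resolventDual_conj, resolventForm]
  refine Finset.sum_le_sum fun i _ => Finset.sum_le_sum fun j _ => ?_
  have hd := convex_comb_eigenvalues_pos hA hB ht i j
  rw [div_mul_eq_mul_div, le_div_iff₀ hd]
  set d := t * hA.isHermitian.eigenvalues i + (1 - t) * hB.isHermitian.eigenvalues j
  set z := ((hA.isHermitian.eigenvectorUnitary : Matrix n n ℝ)ᵀ * W *
        (hB.isHermitian.eigenvectorUnitary : Matrix n n ℝ)) i j
  linarith [sq_nonneg (d * z - overlap hA.isHermitian hB.isHermitian i j *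
    (hA.isHermitian.eigenvalues i - hB.isHermitian.eigenvalues j))]

lemma exists_resolventDual_eq (hA : A.PosDef) (hB : B.PosDef) {t : ℝ} (ht : t ∈ Set.Icc 0 1) :
    ∃ W, resolventDual t A B W = resolventForm hA.isHermitian hB.isHermitian t := by
  -- the maximizers of the decoupled scalar quadratics
  refine ⟨(hA.isHermitian.eigenvectorUnitary : Matrix n n ℝ) *
    Matrix.of (fun i j => overlap hA.isHermitian hB.isHermitian i j *
      (hA.isHermitian.eigenvalues i - hB.isHermitian.eigenvalues j) /
      (t * hA.isHermitian.eigenvalues i + (1 - t) * hB.isHermitian.eigenvalues j)) *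
      (hB.isHermitian.eigenvectorUnitary : Matrix n n ℝ)ᵀ, ?_⟩
  rw [resolventDual_conj, resolventForm]
  refine Finset.sum_congr rfl fun i _ => Finset.sum_congr rfl fun j _ => ?_
  have hd := (convex_comb_eigenvalues_pos hA hB ht i j).ne'
  rw [of_apply]
  field_simp
  ring

lemma resolventForm_convex {A₁ A₂ B₁ B₂ : Matrix n n ℝ} (hA₁ : A₁.PosDef) (hA₂ : A₂.PosDef)
    (hB₁ : B₁.PosDef) (hB₂ : B₂.PosDef) {p q t : ℝ} (hp : 0 ≤ p) (hq : 0 ≤ q)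
    (hA : (p • A₁ + q • A₂).PosDef) (hB : (p • B₁ + q • B₂).PosDef)
    (ht : t ∈ Set.Icc 0 1) :
    resolventForm hA.isHermitian hB.isHermitian t ≤
      p * resolventForm hA₁.isHermitian hB₁.isHermitian t +
        q * resolventForm hA₂.isHermitian hB₂.isHermitian t := by
  obtain ⟨W, hW⟩ := exists_resolventDual_eq hA hB ht
  have h1 := mul_le_mul_of_nonneg_left (resolventDual_le hA₁ hB₁ ht W) hp
  have h2 := mul_le_mul_of_nonneg_left (resolventDual_le hA₂ hB₂ ht W) hq
  have h3 : resolventDual t (p • A₁ + q • A₂) (p • B₁ + q • B₂) W =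
      p * resolventDual t A₁ B₁ W + q * resolventDual t A₂ B₂ W := by
    simp only [resolventDual, Matrix.mul_add, Matrix.add_mul, Matrix.mul_smul, Matrix.smul_mul,
      trace_add, trace_smul, smul_eq_mul]
    ring
  linarith

lemma continuousOn_resolventForm (hA : A.PosDef) (hB : B.PosDef) :
    ContinuousOn (fun t => (1 - t) * resolventForm hA.isHermitian hB.isHermitian t)
      (Set.Icc 0 1) := by
  refine ContinuousOn.mul (by fun_prop) ?_
  unfold resolventForm
  refine continuousOn_finsetSum _ fun i _ => continuousOn_finsetSum _ fun j _ => ?_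
  refine ContinuousOn.mul (ContinuousOn.div (by fun_prop) (by fun_prop) ?_) (by fun_prop)
  exact fun t ht => (convex_comb_eigenvalues_pos hA hB ht i j).ne'

lemma intervalIntegrable_resolventForm (hA : A.PosDef) (hB : B.PosDef) :
    IntervalIntegrable (fun t => (1 - t) * resolventForm hA.isHermitian hB.isHermitian t)
      volume 0 1 := by
  refine ContinuousOn.intervalIntegrable ?_
  rw [Set.uIcc_of_le zero_le_one]
  exact continuousOn_resolventForm hA hB

/-- Integral representation of the relative entropy, from the scalar one by double spectral sums. -/
lemma relEntropy_eq_integral (hA : A.PosDef) (hB : B.PosDef) :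
    relEntropy A B = ∫ t in (0 : ℝ)..1,
      (1 - t) * resolventForm hA.isHermitian hB.isHermitian t := by
  have hA' := hA.isHermitian
  have hB' := hB.isHermitian
  have e1 : (A * cfc Real.log B).trace = (cfc (fun x : ℝ => x) A * cfc Real.log B).trace := by
    rw [cfc_id' ℝ A hA'.isSelfAdjoint]
  have e2 : A.trace = (cfc (fun x : ℝ => x) A).trace := by rw [cfc_id' ℝ A hA'.isSelfAdjoint]
  have e3 : B.trace = (cfc (fun x : ℝ => x) B).trace := by rw [cfc_id' ℝ B hB'.isSelfAdjoint]
  have hint : ∀ i j, IntervalIntegrable (fun t => (1 - t) *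
      ((hA'.eigenvalues i - hB'.eigenvalues j) ^ 2 /
        (t * hA'.eigenvalues i + (1 - t) * hB'.eigenvalues j)) *
          overlap hA' hB' i j ^ 2) volume 0 1 := by
    intro i j
    refine ContinuousOn.intervalIntegrable ?_
    rw [Set.uIcc_of_le zero_le_one]
    refine ContinuousOn.mul (ContinuousOn.mul (by fun_prop)
      (ContinuousOn.div (by fun_prop) (by fun_prop) ?_)) (by fun_prop)
    exact fun t ht => (convex_comb_eigenvalues_pos hA hB ht i j).ne'
  have e4 : (fun t => (1 - t) * resolventForm hA' hB' t) = fun t => ∑ i, ∑ j, (1 - t) *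
      ((hA'.eigenvalues i - hB'.eigenvalues j) ^ 2 /
        (t * hA'.eigenvalues i + (1 - t) * hB'.eigenvalues j)) * overlap hA' hB' i j ^ 2 := by
    funext t
    simp only [resolventForm, Finset.mul_sum, mul_assoc]
  have hint' : ∀ i, IntervalIntegrable (fun t => ∑ j, (1 - t) *
      ((hA'.eigenvalues i - hB'.eigenvalues j) ^ 2 /
        (t * hA'.eigenvalues i + (1 - t) * hB'.eigenvalues j)) *
          overlap hA' hB' i j ^ 2) volume 0 1 := by
    intro i
    simpa only [Finset.sum_fn] using IntervalIntegrable.sum Finset.univ fun j _ => hint i j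
  rw [e4, intervalIntegral.integral_finsetSum fun i _ => hint' i]
  rw [relEntropy, e1, e2, e3, trace_cfc_left hA' hB', trace_cfc_mul_cfc hA' hB',
    trace_cfc_left hA' hB', trace_cfc_right hA' hB', ← Finset.sum_sub_distrib,
    ← Finset.sum_sub_distrib, ← Finset.sum_add_distrib]
  refine Finset.sum_congr rfl fun i _ => ?_
  rw [intervalIntegral.integral_finsetSum fun j _ => hint i j, ← Finset.sum_sub_distrib,
    ← Finset.sum_sub_distrib, ← Finset.sum_add_distrib]
  refine Finset.sum_congr rfl fun j _ => ?_
  rw [intervalIntegral.integral_mul_const,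
    scalar_relEntropy_eq_integral (hA.eigenvalues_pos i) (hB.eigenvalues_pos j)]
  ring

/-- Joint convexity of the relative entropy, inherited from the resolvent forms. -/
lemma relEntropy_convex {A₁ A₂ B₁ B₂ : Matrix n n ℝ} (hA₁ : A₁.PosDef) (hA₂ : A₂.PosDef)
    (hB₁ : B₁.PosDef) (hB₂ : B₂.PosDef) {p q : ℝ} (hp : 0 ≤ p) (hq : 0 ≤ q)
    (hA : (p • A₁ + q • A₂).PosDef) (hB : (p • B₁ + q • B₂).PosDef) :
    relEntropy (p • A₁ + q • A₂) (p • B₁ + q • B₂) ≤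
      p * relEntropy A₁ B₁ + q * relEntropy A₂ B₂ := by
  rw [relEntropy_eq_integral hA hB, relEntropy_eq_integral hA₁ hB₁,
    relEntropy_eq_integral hA₂ hB₂, ← intervalIntegral.integral_const_mul,
    ← intervalIntegral.integral_const_mul, ← intervalIntegral.integral_add
      ((intervalIntegrable_resolventForm hA₁ hB₁).const_mul p)
      ((intervalIntegrable_resolventForm hA₂ hB₂).const_mul q)]
  refine intervalIntegral.integral_mono_on zero_le_one (intervalIntegrable_resolventForm hA hB)
    (((intervalIntegrable_resolventForm hA₁ hB₁).const_mul p).add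
      ((intervalIntegrable_resolventForm hA₂ hB₂).const_mul q)) fun t ht => ?_
  have := mul_le_mul_of_nonneg_left
    (resolventForm_convex hA₁ hA₂ hB₁ hB₂ hp hq hA hB ht) (sub_nonneg.2 ht.2)
  linarith

lemma posDef_convex {m : Type*} {A B : Matrix m m ℝ} (hA : A.PosDef) (hB : B.PosDef) {p q : ℝ}
    (hp : 0 ≤ p) (hq : 0 ≤ q) (hpq : p + q = 1) : (p • A + q • B).PosDef := by
  rcases hp.eq_or_lt with rfl | hp'
  · rw [zero_add] at hpq
    simpa [hpq] using hB
  · exact (hA.smul hp').add_posSemidef (hB.posSemidef.smul hq)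

lemma isHermitian_cfc (f : ℝ → ℝ) (A : Matrix n n ℝ) : (cfc f A).IsHermitian :=
  cfc_predicate (p := IsSelfAdjoint) f A

/-- **Lieb's concavity theorem**: `T ↦ tr exp (K + log T)` is concave on positive definite
matrices. It is the supremum over `S` of `tr (S K) - relEntropy S T + tr T`, attained at
`S = exp (K + log T)`. -/
theorem lieb_concave {K : Matrix n n ℝ} (hK : K.IsHermitian) :
    ConcaveOn ℝ {T : Matrix n n ℝ | T.PosDef} (fun T => trexp (K + cfc Real.log T)) := by
  have key : ∀ T : Matrix n n ℝ, T.PosDef →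
      (cfc Real.exp (K + cfc Real.log T) * K).trace -
        relEntropy (cfc Real.exp (K + cfc Real.log T)) T + T.trace =
          trexp (K + cfc Real.log T) := by
    intro T hT
    have h := klein_exp (hK.add (isHermitian_cfc Real.log T))
    rw [relEntropy, ← h, Matrix.mul_add, trace_add]
    ring
  have key' : ∀ S T : Matrix n n ℝ, S.PosDef → T.PosDef →
      (S * K).trace - relEntropy S T + T.trace ≤ trexp (K + cfc Real.log T) := by
    intro S T hS hT
    have h := klein hS (hK.add (isHermitian_cfc Real.log T))
    rw [Matrix.mul_add, trace_add] at h
    rw [relEntropy]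
    linarith
  refine ⟨fun A hA B hB p q hp hq hpq => posDef_convex hA hB hp hq hpq, ?_⟩
  intro T₁ hT₁ T₂ hT₂ p q hp hq hpq
  have hS₁ := posDef_cfc_exp (hK.add (isHermitian_cfc Real.log T₁))
  have hS₂ := posDef_cfc_exp (hK.add (isHermitian_cfc Real.log T₂))
  have hS := posDef_convex hS₁ hS₂ hp hq hpq
  have hT := posDef_convex hT₁ hT₂ hp hq hpq
  have h1 := key' _ _ hS hT
  have h2 := relEntropy_convex hS₁ hS₂ hT₁ hT₂ hp hq hS hT
  simp only [Matrix.add_mul, Matrix.smul_mul, trace_add, trace_smul, smul_eq_mul] at h1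
  simp only [smul_eq_mul]
  rw [← key T₁ hT₁, ← key T₂ hT₂]
  linarith

end Lieb

/-! ### The influence function and the Loewner order -/

section InfluenceFunction

lemma one_add_add_sq_pos (x : ℝ) : 1 / 2 ≤ 1 + x + x ^ 2 / 2 := by
  nlinarith [sq_nonneg (x + 1)]

lemma continuous_phi : Continuous phi := by
  unfold phi
  refine Continuous.if_le ?_ ?_ continuous_const continuous_id ?_
  · refine Continuous.log (by fun_prop) fun x => ?_
    linarith [one_add_add_sq_pos x]
  · refine (Continuous.log (by fun_prop) fun x => ?_).neg
    have := one_add_add_sq_pos (-x)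
    rw [neg_sq] at this
    linarith
  · rintro x rfl
    simp

lemma phi_neg (x : ℝ) : phi (-x) = -phi x := by
  unfold phi
  rcases lt_trichotomy x 0 with h | rfl | h
  · rw [if_pos (by linarith), if_neg (by linarith)]
    simp [sub_eq_add_neg]
  · simp
  · rw [if_neg (by linarith), if_pos h.le]
    simp

/-- The upper half of the two-sided logarithmic bound on the influence function; for `x < 0` it is
`1 ≤ (1 + x + x² / 2) (1 - x + x² / 2)`. -/
lemma phi_le (x : ℝ) : phi x ≤ Real.log (1 + x + x ^ 2 / 2) := by
  unfold phi
  split_ifs with h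
  · exact le_rfl
  · have h1 := one_add_add_sq_pos x
    have h2 := one_add_add_sq_pos (-x)
    rw [neg_sq] at h2
    have h3 : 0 < 1 - x + x ^ 2 / 2 := by linarith
    rw [← Real.log_inv]
    refine Real.log_le_log (inv_pos.2 h3) ?_
    rw [inv_le_iff_one_le_mul₀ h3]
    nlinarith [sq_nonneg (x ^ 2)]

end InfluenceFunction

section Order

open scoped MatrixOrder

variable {n : Type*} [Fintype n] [DecidableEq n] {A : Matrix n n ℝ}

lemma continuousOn_spectrum (f : ℝ → ℝ) (A : Matrix n n ℝ) : ContinuousOn f (spectrum ℝ A) :=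
  finite_real_spectrum.continuousOn f

lemma le_smul_one_iff (hA : A.IsHermitian) {c : ℝ} :
    A ≤ c • 1 ↔ ∀ x ∈ spectrum ℝ A, x ≤ c := by
  rw [← Algebra.algebraMap_eq_smul_one]
  exact le_algebraMap_iff_spectrum_le hA.isSelfAdjoint

lemma smul_one_le_iff (hA : A.IsHermitian) {c : ℝ} :
    c • 1 ≤ A ↔ ∀ x ∈ spectrum ℝ A, c ≤ x := by
  rw [← Algebra.algebraMap_eq_smul_one]
  exact algebraMap_le_iff_le_spectrum hA.isSelfAdjoint

lemma exists_le_smul_one (hA : A.IsHermitian) : ∃ c : ℝ, A ≤ c • 1 := by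
  obtain ⟨c, hc⟩ := (finite_real_spectrum (A := A)).bddAbove
  exact ⟨c, (le_smul_one_iff hA).2 fun x hx => hc hx⟩

omit [Fintype n] in
lemma isHermitian_of_smul_one_le {c : ℝ} (h : c • 1 ≤ A) : A.IsHermitian := by
  have := (le_iff.1 h).isHermitian.add
    ((isHermitian_one (n := n) (α := ℝ)).smul (k := c) (by simp [IsSelfAdjoint]))
  simpa using this

omit [Fintype n] in
lemma posDef_of_smul_one_le {c : ℝ} (hc : 0 < c) (h : c • 1 ≤ A) : A.PosDef := by
  have := (PosDef.one (n := n) (R := ℝ)).smul hc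
  simpa using this.add_posSemidef (le_iff.1 h)

lemma trexp_smul_one (c : ℝ) : trexp (c • (1 : Matrix n n ℝ)) = Fintype.card n * Real.exp c := by
  have h : (c • (1 : Matrix n n ℝ)).IsHermitian := isHermitian_one.smul (by simp [IsSelfAdjoint])
  rw [trexp_eq_trace_cfc h, ← Algebra.algebraMap_eq_smul_one, cfc_algebraMap,
    Algebra.algebraMap_eq_smul_one, trace_smul, trace_one, smul_eq_mul, mul_comm]

lemma trexp_add_log_le {K T : Matrix n n ℝ} (hK : K.IsHermitian) (hT : T.PosDef) {c : ℝ}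
    (hc : K ≤ c • 1) : trexp (K + cfc Real.log T) ≤ Real.exp c * T.trace := by
  have hT' := hT.isHermitian.isSelfAdjoint
  have h1 : c • 1 + cfc Real.log T = cfc (fun x => c + Real.log x) T := by
    rw [cfc_const_add c Real.log T (continuousOn_spectrum _ _) hT',
      Algebra.algebraMap_eq_smul_one]
  have h2 : trexp (c • 1 + cfc Real.log T) = Real.exp c * T.trace := by
    rw [h1, trexp_eq_trace_cfc (isHermitian_cfc _ _), ← cfc_comp' Real.exp _ T
      (by fun_prop) (continuousOn_spectrum _ _) hT']
    conv_rhs => rw [← smul_eq_mul, ← trace_smul, ← cfc_id' ℝ T hT',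
      ← cfc_smul (Real.exp c) _ T (continuousOn_spectrum _ _)]
    congr 1
    refine cfc_congr fun x hx => ?_
    have hx' : 0 < x := by
      rw [hT.isHermitian.spectrum_real_eq_range_eigenvalues] at hx
      obtain ⟨i, rfl⟩ := hx
      exact hT.eigenvalues_pos i
    simp [Real.exp_add, Real.exp_log hx']
  rw [← h2]
  refine trexp_mono (hK.add (isHermitian_cfc _ _)) ?_ (by gcongr)
  rw [h1]
  exact isHermitian_cfc _ _

/-- A symmetric matrix is at most the logarithm of the trace of its exponential. -/
lemma le_smul_one_of_trexp_le (hA : A.IsHermitian) {c : ℝ} (h : trexp A ≤ Real.exp c) :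
    A ≤ c • 1 := by
  rw [le_smul_one_iff hA]
  intro x hx
  rw [hA.spectrum_real_eq_range_eigenvalues] at hx
  obtain ⟨i, rfl⟩ := hx
  rw [trexp_eq_sum hA] at h
  refine Real.exp_le_exp.1 (le_trans ?_ h)
  exact Finset.single_le_sum (f := fun i => Real.exp (hA.eigenvalues i))
    (fun j _ => (Real.exp_pos _).le) (Finset.mem_univ i)

lemma isClosed_smul_one_le (c : ℝ) : IsClosed {T : Matrix n n ℝ | c • 1 ≤ T} := by
  have : {T : Matrix n n ℝ | c • 1 ≤ T} = {T | (T - c • 1)ᵀ = T - c • 1} ∩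
      ⋂ x : n → ℝ, {T | 0 ≤ x ⬝ᵥ ((T - c • 1) *ᵥ x)} := by
    ext T
    simp [le_iff, posSemidef_iff_dotProduct_mulVec, IsHermitian]
  rw [this]
  refine IsClosed.inter (isClosed_eq (by fun_prop) (by fun_prop)) (isClosed_iInter fun x => ?_)
  exact isClosed_le continuous_const (by fun_prop)

omit [Fintype n] in
lemma convex_smul_one_le (c : ℝ) : Convex ℝ {T : Matrix n n ℝ | c • 1 ≤ T} := by
  intro A hA B hB p q hp hq hpq
  have h1 := (le_iff.1 hA).smul hp
  have h2 := (le_iff.1 hB).smul hq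
  have h3 := h1.add h2
  rw [Set.mem_ofPred_eq, le_iff]
  convert h3 using 1
  rw [smul_sub, smul_sub, smul_smul, smul_smul]
  have : c • (1 : Matrix n n ℝ) = (p * c) • 1 + (q * c) • 1 := by
    rw [← add_smul, ← add_mul, hpq, one_mul]
  rw [this]
  abel

lemma continuousOn_cfc_log {c : ℝ} (hc : 0 < c) :
    ContinuousOn (fun T : Matrix n n ℝ => cfc Real.log T) {T | c • 1 ≤ T} := by
  refine ContinuousOn.cfc_of_mem_nhdsSet (s := {x | x ≠ 0}) Real.log ?_ continuousOn_id
    (fun T hT => (isHermitian_of_smul_one_le hT).isSelfAdjoint) Real.continuousOn_log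
  refine (isOpen_ne.mem_nhdsSet).2 (Set.iUnion₂_subset fun T hT x hx => ?_)
  have := (smul_one_le_iff (isHermitian_of_smul_one_le hT)).1 hT x hx
  exact (hc.trans_le this).ne'

end Order

/-! ### Matrix Laplace transform -/

section Laplace

open scoped MatrixOrder

/-- The σ-algebra of the entries is the Borel σ-algebra. -/
instance matrixBorelSpace (m n : Type) [Fintype m] [Fintype n] : BorelSpace (Matrix m n ℝ) :=
  inferInstanceAs (BorelSpace (m → n → ℝ))

variable {n : Type} [Fintype n] [DecidableEq n] {Ω : Type*} [MeasurableSpace Ω] {μ : Measure Ω}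

lemma measurable_cfc {f : ℝ → ℝ} (hf : Continuous f) {H : Ω → Matrix n n ℝ} (hH : Measurable H)
    (hsymm : ∀ ω, (H ω).IsHermitian) : Measurable fun ω => cfc f (H ω) := by
  have hc : Continuous fun A : {A : Matrix n n ℝ // IsSelfAdjoint A} => cfc f A.1 :=
    Continuous.cfc_of_mem_nhdsSet (s := Set.univ) f Filter.univ_mem continuous_subtype_val
      (fun A => A.2) hf.continuousOn
  exact hc.measurable.comp (hH.subtype_mk (h := fun ω => (hsymm ω).isSelfAdjoint))

/-- Lieb's theorem and Jensen's inequality for a random matrix that is bounded below. -/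
lemma integral_trexp_add_log_le [IsProbabilityMeasure μ] {K : Matrix n n ℝ} (hK : K.IsHermitian)
    {T : Ω → Matrix n n ℝ} {c : ℝ} (hc : 0 < c) (hT : ∀ ω, c • 1 ≤ T ω) (hTi : Integrable T μ) :
    Integrable (fun ω => trexp (K + cfc Real.log (T ω))) μ ∧
      ∫ ω, trexp (K + cfc Real.log (T ω)) ∂μ ≤ trexp (K + cfc Real.log (∫ ω, T ω ∂μ)) := by
  have hcont : ContinuousOn (fun T : Matrix n n ℝ => trexp (K + cfc Real.log T))
      {T | c • 1 ≤ T} :=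
    continuous_trexp.comp_continuousOn (continuousOn_const.add (continuousOn_cfc_log hc))
  -- integrability, from `tr exp (K + log T) ≤ exp k * tr T` when `K ≤ k`
  obtain ⟨k, hk⟩ := exists_le_smul_one hK
  have hint : Integrable (fun ω => trexp (K + cfc Real.log (T ω))) μ := by
    have hb : Integrable (fun ω => Real.exp k * (T ω).trace) μ :=
      (((traceLinearMap n ℝ ℝ).toContinuousLinearMap).integrable_comp hTi).const_mul _
    refine hb.mono' ?_ (Filter.Eventually.of_forall fun ω => ?_)
    · have h1 : StronglyMeasurable ({T : Matrix n n ℝ | c • 1 ≤ T}.indicator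
          fun T => trexp (K + cfc Real.log T)) := by
        classical
        refine Measurable.stronglyMeasurable ?_
        rw [← Set.piecewise_eq_indicator]
        have := hcont.measurable_piecewise (continuousOn_const (c := (0 : ℝ)))
          (isClosed_smul_one_le (n := n) c).measurableSet
        exact this
      have h2 := h1.measurable.comp_aemeasurable hTi.aestronglyMeasurable.aemeasurable
      refine (h2.congr (Filter.Eventually.of_forall fun ω => ?_)).aestronglyMeasurable
      exact Set.indicator_of_mem (s := {T : Matrix n n ℝ | c • 1 ≤ T}) (hT ω)
        (fun T => trexp (K + cfc Real.log T))
    · rw [Real.norm_of_nonneg (trexp_nonneg (hK.add (isHermitian_cfc _ _)))]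
      exact trexp_add_log_le hK (posDef_of_smul_one_le hc (hT ω)) hk
  refine ⟨hint, ?_⟩
  refine ((lieb_concave hK).subset (fun T hT => posDef_of_smul_one_le hc hT)
    (convex_smul_one_le c)).le_map_integral hcont (isClosed_smul_one_le c)
    (Filter.Eventually.of_forall hT) hTi hint

lemma one_add_add_sq_eq_cfc {X : Matrix n n ℝ} (hX : X.IsHermitian) :
    1 + X + (1 / 2 : ℝ) • (X * X) = cfc (fun x : ℝ => 1 + x + x ^ 2 / 2) X := by
  have hs := hX.isSelfAdjoint
  have e : (fun x : ℝ => 1 + x + x ^ 2 / 2) = fun x => (1 + x) + (1 / 2 : ℝ) • x ^ 2 := by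
    funext x
    simp only [smul_eq_mul]
    ring
  rw [e, cfc_add _ (fun x : ℝ => 1 + x) (fun x : ℝ => (1 / 2 : ℝ) • x ^ 2)
      (continuousOn_spectrum _ _) (continuousOn_spectrum _ _),
    cfc_const_add (1 : ℝ) (fun x : ℝ => x) _ (continuousOn_spectrum _ _) hs, cfc_id' ℝ _ hs,
    cfc_smul (1 / 2 : ℝ) (fun x : ℝ => x ^ 2) _ (continuousOn_spectrum _ _),
    cfc_pow_id (R := ℝ) _ 2 hs, map_one, sq]

lemma cfc_phi_le_log {X : Matrix n n ℝ} (hX : X.IsHermitian) :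
    cfc phi X ≤ cfc Real.log (1 + X + (1 / 2 : ℝ) • (X * X)) := by
  rw [one_add_add_sq_eq_cfc hX, ← cfc_comp' Real.log _ _
    ((finite_real_spectrum.image _).continuousOn _) (continuousOn_spectrum _ _) hX.isSelfAdjoint]
  exact cfc_mono (fun x _ => phi_le x) (continuousOn_spectrum _ _) (continuousOn_spectrum _ _)

lemma half_le_one_add_add_sq {X : Matrix n n ℝ} (hX : X.IsHermitian) :
    (1 / 2 : ℝ) • 1 ≤ 1 + X + (1 / 2 : ℝ) • (X * X) := by
  rw [one_add_add_sq_eq_cfc hX, ← Algebra.algebraMap_eq_smul_one]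
  exact algebraMap_le_cfc _ _ _ (fun x _ => one_add_add_sq_pos x) (continuousOn_spectrum _ _)
    hX.isSelfAdjoint

lemma cfc_log_le_sub_one {T : Matrix n n ℝ} (hT : T.PosDef) : cfc Real.log T ≤ T - 1 := by
  have hs := hT.isHermitian.isSelfAdjoint
  have h1 : cfc Real.log T ≤ cfc (fun x : ℝ => x - 1) T := by
    refine cfc_mono (fun x hx => ?_) (continuousOn_spectrum _ _) (continuousOn_spectrum _ _)
    rw [hT.isHermitian.spectrum_real_eq_range_eigenvalues] at hx
    obtain ⟨i, rfl⟩ := hx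
    exact Real.log_le_sub_one_of_pos (hT.eigenvalues_pos i)
  rwa [cfc_sub (fun x : ℝ => x) (fun _ => 1) _ (continuousOn_spectrum _ _)
    (continuousOn_spectrum _ _), cfc_id' ℝ _ hs, cfc_const_one ℝ _ hs] at h1

lemma smul_le_smul_matrix {m : Type*} {A B : Matrix m m ℝ} (h : A ≤ B) {c : ℝ} (hc : 0 ≤ c) :
    c • A ≤ c • B := by
  have := (le_iff.1 h).smul hc
  rwa [smul_sub] at this

lemma trexp_add_mono {K A B : Matrix n n ℝ} (hK : K.IsHermitian) (hA : A.IsHermitian)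
    (hB : B.IsHermitian) (hAB : A ≤ B) : trexp (K + A) ≤ trexp (K + B) := by
  refine trexp_mono (hK.add hA) (hK.add hB) ?_
  rwa [le_iff, add_sub_add_left_eq_sub, ← le_iff]

/-- One summand of the matrix Laplace transform bound: the influence function is dominated by
`log (1 + x + x² / 2)`, and the expectation is moved inside the logarithm. -/
lemma lintegral_trexp_add_phi_le [IsProbabilityMeasure μ] {K : Matrix n n ℝ} (hK : K.IsHermitian)
    {X : Ω → Matrix n n ℝ} (hsymm : ∀ ω, (X ω).IsHermitian) {Xbar : Matrix n n ℝ} {w : ℝ}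
    (hX1 : Integrable X μ) (hX2 : Integrable (fun ω => X ω * X ω) μ)
    (hmean : ∫ ω, X ω ∂μ = Xbar) (hvar : ∫ ω, X ω * X ω ∂μ ≤ w • 1) (hXbar : Xbar.IsHermitian) :
    ∫⁻ ω, ENNReal.ofReal (trexp (K + cfc phi (X ω))) ∂μ ≤
      ENNReal.ofReal (trexp (K + (Xbar + (w / 2) • 1))) := by
  have hTi : Integrable (fun ω => 1 + X ω + (1 / 2 : ℝ) • (X ω * X ω)) μ :=
    ((integrable_const 1).add hX1).add (hX2.smul (1 / 2 : ℝ))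
  obtain ⟨hint, hle⟩ := integral_trexp_add_log_le hK (by norm_num)
    (fun ω => half_le_one_add_add_sq (hsymm ω)) hTi
  have hae : ∀ᵐ ω ∂μ, 1 + X ω + (1 / 2 : ℝ) • (X ω * X ω) ∈
      {T : Matrix n n ℝ | (1 / 2 : ℝ) • 1 ≤ T} :=
    Filter.Eventually.of_forall fun ω => half_le_one_add_add_sq (hsymm ω)
  have hconv : Convex ℝ {T : Matrix n n ℝ | (1 / 2 : ℝ) • 1 ≤ T} := convex_smul_one_le (1 / 2)
  have hmem : ∫ ω, (1 + X ω + (1 / 2 : ℝ) • (X ω * X ω)) ∂μ ∈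
      {T : Matrix n n ℝ | (1 / 2 : ℝ) • 1 ≤ T} :=
    hconv.integral_mem (isClosed_smul_one_le (1 / 2)) hae hTi
  rw [Set.mem_ofPred_eq] at hmem
  have hpd := posDef_of_smul_one_le (by norm_num) hmem
  have hTbar : ∫ ω, (1 + X ω + (1 / 2 : ℝ) • (X ω * X ω)) ∂μ =
      1 + Xbar + (1 / 2 : ℝ) • ∫ ω, X ω * X ω ∂μ := by
    have h1 : Integrable (fun ω => 1 + X ω) μ := (integrable_const 1).add hX1
    have h2 : Integrable (fun ω => (1 / 2 : ℝ) • (X ω * X ω)) μ := hX2.smul (1 / 2 : ℝ)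
    rw [integral_add h1 h2, integral_add (integrable_const 1) hX1, integral_smul, hmean,
      integral_const, probReal_univ, one_smul]
  have hlog : cfc Real.log (∫ ω, (1 + X ω + (1 / 2 : ℝ) • (X ω * X ω)) ∂μ) ≤
      Xbar + (w / 2) • 1 := by
    refine (cfc_log_le_sub_one hpd).trans ?_
    rw [hTbar]
    have h2 := smul_le_smul_matrix hvar (show (0 : ℝ) ≤ 1 / 2 by norm_num)
    rw [smul_smul, one_div_mul_eq_div] at h2
    rw [le_iff] at h2 ⊢
    convert h2 using 1
    abel
  have hnonneg : ∀ ω, 0 ≤ trexp (K + cfc Real.log (1 + X ω + (1 / 2 : ℝ) • (X ω * X ω))) :=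
    fun ω => trexp_nonneg (hK.add (isHermitian_cfc _ _))
  calc ∫⁻ ω, ENNReal.ofReal (trexp (K + cfc phi (X ω))) ∂μ
      ≤ ∫⁻ ω, ENNReal.ofReal
          (trexp (K + cfc Real.log (1 + X ω + (1 / 2 : ℝ) • (X ω * X ω)))) ∂μ := by
        refine lintegral_mono fun ω => ENNReal.ofReal_le_ofReal ?_
        exact trexp_add_mono hK (isHermitian_cfc _ _) (isHermitian_cfc _ _)
          (cfc_phi_le_log (hsymm ω))
    _ = ENNReal.ofReal
          (∫ ω, trexp (K + cfc Real.log (1 + X ω + (1 / 2 : ℝ) • (X ω * X ω))) ∂μ) :=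
        (ofReal_integral_eq_lintegral_ofReal hint (Filter.Eventually.of_forall hnonneg)).symm
    _ ≤ _ := by
        refine ENNReal.ofReal_le_ofReal (hle.trans ?_)
        exact trexp_add_mono hK (isHermitian_cfc _ _)
          (hXbar.add (isHermitian_one.smul (by simp [IsSelfAdjoint]))) hlog

/-- Subadditivity of the matrix cumulant generating function, for independent symmetric summands
`G k` whose exponential moments are controlled by `C k` against every symmetric shift `K`. -/
lemma lintegral_trexp_sum_le [IsProbabilityMeasure μ] {ι : Type*} [DecidableEq ι]
    {G : ι → Ω → Matrix n n ℝ} {C : ι → Matrix n n ℝ} (hG : ∀ k, Measurable (G k))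
    (hsymm : ∀ k ω, (G k ω).IsHermitian) (hC : ∀ k, (C k).IsHermitian) (hindep : iIndepFun G μ)
    (hle : ∀ k, ∀ K : Matrix n n ℝ, K.IsHermitian →
      ∫⁻ ω, ENNReal.ofReal (trexp (K + G k ω)) ∂μ ≤ ENNReal.ofReal (trexp (K + C k)))
    (s : Finset ι) : ∀ {K : Matrix n n ℝ}, K.IsHermitian →
      ∫⁻ ω, ENNReal.ofReal (trexp (K + ∑ k ∈ s, G k ω)) ∂μ ≤
        ENNReal.ofReal (trexp (K + ∑ k ∈ s, C k)) := by
  induction s using Finset.induction_on with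
  | empty => intro K _; simp
  | insert a s ha ih =>
    intro K hK
    have hS : Measurable fun ω => ∑ k ∈ s, G k ω :=
      Finset.measurable_sum s fun k _ => hG k
    have hind : IndepFun (fun ω => ∑ k ∈ s, G k ω) (G a) μ := by
      have := hindep.indepFun_finsetSum_of_notMem hG ha
      rwa [Finset.sum_fn] at this
    have hSsymm : ∀ ω, (∑ k ∈ s, G k ω).IsHermitian := fun ω => by
      rw [IsHermitian, conjTranspose_sum]
      exact Finset.sum_congr rfl fun k _ => hsymm k ω
    have hmeas : Measurable fun p : Matrix n n ℝ × Matrix n n ℝ =>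
        ENNReal.ofReal (trexp (K + p.1 + p.2)) :=
      (continuous_trexp.measurable.comp (by fun_prop)).ennreal_ofReal
    calc ∫⁻ ω, ENNReal.ofReal (trexp (K + ∑ k ∈ insert a s, G k ω)) ∂μ
        = ∫⁻ ω, ENNReal.ofReal (trexp (K + (∑ k ∈ s, G k ω) + G a ω)) ∂μ := by
          refine lintegral_congr fun ω => ?_
          rw [Finset.sum_insert ha, add_comm (G a ω), add_assoc]
      -- by independence, the law of the pair is a product measure
      _ = ∫⁻ p, ENNReal.ofReal (trexp (K + p.1 + p.2))
            ∂(μ.map fun ω => (∑ k ∈ s, G k ω, G a ω)) :=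
          (lintegral_map hmeas (hS.prodMk (hG a))).symm
      _ = ∫⁻ ω, ∫⁻ ω', ENNReal.ofReal (trexp (K + (∑ k ∈ s, G k ω) + G a ω')) ∂μ ∂μ := by
          rw [(indepFun_iff_map_prod_eq_prod_map_map hS.aemeasurable (hG a).aemeasurable).1 hind]
          have := Measure.isProbabilityMeasure_map (μ := μ) (hG a).aemeasurable
          rw [lintegral_prod _ hmeas.aemeasurable, lintegral_map hmeas.lintegral_prod_right' hS]
          refine lintegral_congr fun ω => ?_
          exact lintegral_map (hmeas.comp measurable_prodMk_left) (hG a)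
      _ ≤ ∫⁻ ω, ENNReal.ofReal (trexp ((K + C a) + ∑ k ∈ s, G k ω)) ∂μ := by
          refine lintegral_mono fun ω => (hle a _ (hK.add (hSsymm ω))).trans_eq ?_
          rw [add_right_comm]
      _ ≤ ENNReal.ofReal (trexp ((K + C a) + ∑ k ∈ s, C k)) := ih (hK.add (hC a))
      _ = _ := by rw [Finset.sum_insert ha, add_assoc]

end Laplace

/-! ### Hermitian dilations -/

section Dilation

open scoped MatrixOrder

variable {d₁ d₂ : ℕ}

lemma matrix_eq_zero_of_eq_neg {m n : Type*} {A : Matrix m n ℝ} (h : A = -A) : A = 0 := by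
  ext i j
  have := congrFun (congrFun h i) j
  rw [Matrix.neg_apply] at this
  rw [Matrix.zero_apply]
  linarith

lemma isHermitian_dilation (A : Matrix (Fin d₁) (Fin d₂) ℝ) : (dilation A).IsHermitian := by
  rw [IsHermitian, dilation, fromBlocks_conjTranspose]
  simp

lemma dilation_sub (A C : Matrix (Fin d₁) (Fin d₂) ℝ) :
    dilation (A - C) = dilation A - dilation C := by
  simp [dilation, sub_eq_add_neg, fromBlocks_add, fromBlocks_neg]

lemma dilation_smul (c : ℝ) (A : Matrix (Fin d₁) (Fin d₂) ℝ) :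
    dilation (c • A) = c • dilation A := by
  simp [dilation, fromBlocks_smul]

lemma dilation_mul_self (A : Matrix (Fin d₁) (Fin d₂) ℝ) :
    dilation A * dilation A = fromBlocks (A * Aᵀ) 0 0 (Aᵀ * A) := by
  simp [dilation, fromBlocks_multiply]

/-- The symmetry `diag (1, -1)`, conjugation by which changes the sign of every dilation. -/
def signFlip (d₁ d₂ : ℕ) : Matrix (Fin d₁ ⊕ Fin d₂) (Fin d₁ ⊕ Fin d₂) ℝ :=
  fromBlocks 1 0 0 (-1)

lemma signFlip_mul_self : signFlip d₁ d₂ * signFlip d₁ d₂ = 1 := by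
  simp [signFlip, fromBlocks_multiply]

lemma star_signFlip : star (signFlip d₁ d₂) = signFlip d₁ d₂ := by
  rw [star_eq_conjTranspose, signFlip, fromBlocks_conjTranspose]
  simp

/-- An odd function of a dilation is again a dilation. -/
lemma cfc_phi_dilation (A : Matrix (Fin d₁) (Fin d₂) ℝ) :
    cfc phi (dilation A) = dilation (cfc phi (dilation A)).toBlocks₁₂ := by
  have hJ : signFlip d₁ d₂ ∈ unitary (Matrix (Fin d₁ ⊕ Fin d₂) (Fin d₁ ⊕ Fin d₂) ℝ) := by
    rw [Unitary.mem_iff, star_signFlip, signFlip_mul_self]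
    exact ⟨rfl, rfl⟩
  have h1 : signFlip d₁ d₂ * dilation A * signFlip d₁ d₂ = -dilation A := by
    simp [signFlip, dilation, fromBlocks_multiply, fromBlocks_neg]
  have hs := (isHermitian_dilation A).isSelfAdjoint
  have h2 : signFlip d₁ d₂ * cfc phi (dilation A) * signFlip d₁ d₂ = -cfc phi (dilation A) := by
    have h := StarAlgHomClass.map_cfc (S := ℝ)
      (Unitary.conjStarAlgAut ℝ (Matrix (Fin d₁ ⊕ Fin d₂) (Fin d₁ ⊕ Fin d₂) ℝ) ⟨_, hJ⟩) phi
      (dilation A) (continuousOn_spectrum _ _)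
      (show Continuous fun T => signFlip d₁ d₂ * T * star (signFlip d₁ d₂) by fun_prop) hs
      (by
        simp only [Unitary.conjStarAlgAut_apply, star_signFlip, h1]
        exact hs.neg)
    simp only [Unitary.conjStarAlgAut_apply, star_signFlip, h1] at h
    rw [h, ← cfc_comp_neg phi (dilation A) (continuous_phi.continuousOn) hs, ← cfc_neg]
    simp only [phi_neg]
  have hherm := isHermitian_cfc phi (dilation A)
  set S := cfc phi (dilation A) with hS
  rw [← fromBlocks_toBlocks S] at h2 hherm ⊢
  rw [IsHermitian, fromBlocks_conjTranspose, fromBlocks_inj] at hherm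
  simp only [signFlip, fromBlocks_multiply, fromBlocks_neg, fromBlocks_inj] at h2
  rw [toBlocks_fromBlocks₁₂, dilation, fromBlocks_inj]
  refine ⟨?_, rfl, ?_, ?_⟩
  · have := h2.1
    simp only [Matrix.one_mul, Matrix.mul_one, Matrix.zero_mul, Matrix.mul_zero, add_zero] at this
    exact matrix_eq_zero_of_eq_neg this
  · rw [← conjTranspose_eq_transpose_of_trivial]
    exact hherm.2.2.1.symm
  · have := h2.2.2.2
    simp only [Matrix.neg_mul, Matrix.mul_neg, Matrix.one_mul, Matrix.mul_one, Matrix.zero_mul,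
      Matrix.mul_zero, zero_add, neg_neg] at this
    exact matrix_eq_zero_of_eq_neg this

lemma norm_toLp_sq {n : Type*} [Fintype n] (v : n → ℝ) : ‖WithLp.toLp 2 v‖ ^ 2 = v ⬝ᵥ v := by
  rw [EuclideanSpace.norm_sq_eq]
  simp [dotProduct, sq]

/-- The operator norm of a matrix is at most the largest eigenvalue of its dilation. -/
lemma norm_le_of_dilation_le {A : Matrix (Fin d₁) (Fin d₂) ℝ} {c : ℝ} (hc : 0 ≤ c)
    (h : dilation A ≤ c • 1) : ‖A‖ ≤ c := by
  rw [l2_opNorm_def]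
  refine ContinuousLinearMap.opNorm_le_bound _ hc fun x => ?_
  obtain ⟨v, rfl⟩ : ∃ v, x = WithLp.toLp 2 v := ⟨x.ofLp, rfl⟩
  change ‖WithLp.toLp 2 (A *ᵥ v)‖ ≤ c * ‖WithLp.toLp 2 v‖
  set a := ‖WithLp.toLp 2 (A *ᵥ v)‖ with ha
  set b := ‖WithLp.toLp 2 v‖ with hb
  have ha2 : a ^ 2 = (A *ᵥ v) ⬝ᵥ (A *ᵥ v) := norm_toLp_sq _
  have hb2 : b ^ 2 = v ⬝ᵥ v := norm_toLp_sq _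
  have ha0 : 0 ≤ a := norm_nonneg _
  have hb0 : 0 ≤ b := norm_nonneg _
  -- The block vector `(b A v, a v)`, with `a = ‖A v‖` and `b = ‖v‖`, has equally long blocks, so it
  -- turns the quadratic form of the dilation into the sharp bilinear bound.
  have key := (le_iff.1 h).dotProduct_mulVec_nonneg (Sum.elim (b • (A *ᵥ v)) (a • v))
  rw [sub_mulVec, dotProduct_sub, dilation, fromBlocks_mulVec, star_trivial, smul_mulVec,
    one_mulVec, dotProduct_smul, sumElim_dotProduct_sumElim, sumElim_dotProduct_sumElim] at key
  simp only [Function.comp_def, Sum.elim_inl, Sum.elim_inr, zero_mulVec, smul_zero,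
    zero_add, add_zero, mulVec_smul, smul_dotProduct, dotProduct_smul, smul_eq_mul] at key
  have e1 : v ⬝ᵥ (Aᵀ *ᵥ (A *ᵥ v)) = a ^ 2 := by
    rw [ha2, dotProduct_mulVec, vecMul_transpose]
  rw [e1, ← ha2, ← hb2] at key
  rcases ha0.eq_or_lt with h0 | h0
  · rw [← h0]
    positivity
  · rcases hb0.eq_or_lt with h1 | h1
    · exfalso
      rw [← h1] at hb2
      have hv : v = 0 := by
        refine dotProduct_self_eq_zero.1 ?_
        rw [← hb2]
        norm_num
      rw [hv, mulVec_zero, dotProduct_zero] at ha2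
      exact h0.ne' (by simpa using ha2)
    · have h2 : 0 < a ^ 2 * b := by positivity
      have h3 : a ^ 2 * b * a ≤ a ^ 2 * b * (c * b) := by linarith
      exact le_of_mul_le_mul_left h3 h2

lemma norm_le_of_posSemidef_of_le {n : Type*} [Fintype n] [DecidableEq n] {P : Matrix n n ℝ}
    {c : ℝ} (hc : 0 ≤ c) (hP : P.PosSemidef) (h : P ≤ c • 1) : ‖P‖ ≤ c := by
  rw [← cfc_id' ℝ P hP.isHermitian.isSelfAdjoint]
  refine norm_cfc_le hc fun x hx => ?_
  have h1 := (le_smul_one_iff hP.isHermitian).1 h x hx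
  rw [hP.isHermitian.spectrum_real_eq_range_eigenvalues] at hx
  obtain ⟨i, rfl⟩ := hx
  rwa [Real.norm_of_nonneg (hP.eigenvalues_nonneg i)]

lemma fromBlocks_diagonal_le {P : Matrix (Fin d₁) (Fin d₁) ℝ} {R : Matrix (Fin d₂) (Fin d₂) ℝ}
    {c : ℝ} (hP : P ≤ c • 1) (hR : R ≤ c • 1) : fromBlocks P 0 0 R ≤ c • 1 := by
  have hP' := le_iff.1 hP
  have hR' := le_iff.1 hR
  have e : c • (1 : Matrix (Fin d₁ ⊕ Fin d₂) (Fin d₁ ⊕ Fin d₂) ℝ) - fromBlocks P 0 0 R =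
      fromBlocks (c • 1 - P) 0 0 (c • 1 - R) := by
    rw [← fromBlocks_one, fromBlocks_smul, sub_eq_add_neg, fromBlocks_neg, fromBlocks_add]
    simp [sub_eq_add_neg]
  rw [le_iff, e]
  refine PosSemidef.of_dotProduct_mulVec_nonneg
    (IsHermitian.fromBlocks hP'.isHermitian (by simp) hR'.isHermitian) fun x => ?_
  have h1 := hP'.dotProduct_mulVec_nonneg (x ∘ Sum.inl)
  have h2 := hR'.dotProduct_mulVec_nonneg (x ∘ Sum.inr)
  have hx : x = Sum.elim (x ∘ Sum.inl) (x ∘ Sum.inr) := (Sum.elim_comp_inl_inr x).symm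
  rw [fromBlocks_mulVec, star_trivial]
  conv_rhs => rw [hx]
  rw [sumElim_dotProduct_sumElim]
  simpa using add_nonneg h1 h2

/-- A bound on the trace exponential of the centred sum controls the error of the robust mean. -/
lemma norm_robustMean_sub_le {n : ℕ} (hn : 0 < n) {ν c : ℝ} (hν : 0 < ν) (hc : 0 ≤ c)
    (M : Fin n → Matrix (Fin d₁) (Fin d₂) ℝ) (D : Matrix (Fin d₁) (Fin d₂) ℝ)
    (h : trexp (-((n * ν) • dilation D) + ∑ k, cfc phi (ν • dilation (M k))) ≤ Real.exp c) :
    ‖robustMean ν M - D‖ ≤ c / (n * ν) := by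
  have hnν : 0 < n * ν := mul_pos (Nat.cast_pos.2 hn) hν
  set G : Matrix (Fin d₁) (Fin d₂) ℝ := (∑ k, cfc phi (ν • dilation (M k))).toBlocks₁₂ with hG
  have hsum : ∑ k, cfc phi (ν • dilation (M k)) = dilation G := by
    have h1 : ∀ k, cfc phi (ν • dilation (M k)) =
        dilation (cfc phi (ν • dilation (M k))).toBlocks₁₂ := by
      intro k
      rw [← dilation_smul]
      exact cfc_phi_dilation _
    have h2 : G = ∑ k, (cfc phi (ν • dilation (M k))).toBlocks₁₂ := by
      ext i j
      simp [hG, toBlocks₁₂, Matrix.sum_apply]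
    rw [h2, Finset.sum_congr rfl fun k _ => h1 k]
    ext i j
    rcases i with i | i <;> rcases j with j | j <;>
      simp [dilation, Matrix.sum_apply]
  have hS : -((n * ν) • dilation D) + ∑ k, cfc phi (ν • dilation (M k)) =
      dilation (G - (n * ν) • D) := by
    rw [hsum, dilation_sub, dilation_smul]
    abel
  rw [hS] at h
  have h1 := norm_le_of_dilation_le hc (le_smul_one_of_trexp_le (isHermitian_dilation _) h)
  have h2 : robustMean ν M - D = (1 / (n * ν)) • (G - (n * ν) • D) := by
    rw [robustMean, ← hG, smul_sub, smul_smul, one_div_mul_cancel hnν.ne', one_smul]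
  rw [h2, norm_smul, Real.norm_of_nonneg (by positivity), one_div_mul_eq_div]
  gcongr

end Dilation

/-! ### Deviation of the robust matrix mean -/

section MatrixIntegral

variable {m n : Type} [Fintype m] [Fintype n] [DecidableEq n]
  {Ω : Type*} [MeasurableSpace Ω] {μ : Measure Ω}

/-- The evaluation of a matrix at an entry, as a continuous linear functional. -/
noncomputable def entryCLM (i : m) (j : n) : Matrix m n ℝ →L[ℝ] ℝ :=
  (entryLinearMap ℝ ℝ i j).toContinuousLinearMap

lemma integrable_matrix_iff [DecidableEq m] {F : Ω → Matrix m n ℝ} :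
    Integrable F μ ↔ ∀ i j, Integrable (fun ω => F ω i j) μ := by
  refine ⟨fun h i j => (entryCLM i j).integrable_comp h, fun h => ?_⟩
  have e : F = fun ω => ∑ i, ∑ j, F ω i j • Matrix.single i j (1 : ℝ) := by
    funext ω
    conv_lhs => rw [matrix_eq_sum_single (F ω)]
    simp
  rw [e]
  exact integrable_finsetSum _ fun i _ => integrable_finsetSum _ fun j _ => (h i j).smul_const _

lemma integral_matrix_apply {F : Ω → Matrix m n ℝ} (hF : Integrable F μ) (i : m) (j : n) :
    (∫ ω, F ω ∂μ) i j = ∫ ω, F ω i j ∂μ :=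
  ((entryCLM i j).integral_comp_comm hF).symm

end MatrixIntegral

section Tail

open scoped MatrixOrder

variable {d₁ d₂ : ℕ} {Ω : Type*} [MeasurableSpace Ω] {μ : Measure Ω}

lemma continuous_dilation :
    Continuous (dilation : Matrix (Fin d₁) (Fin d₂) ℝ → Matrix _ _ ℝ) :=
  continuous_const.matrix_fromBlocks continuous_id continuous_id.matrix_transpose continuous_const

lemma integrable_dilation {M : Ω → Matrix (Fin d₁) (Fin d₂) ℝ} (hM : Integrable M μ) :
    Integrable (fun ω => dilation (M ω)) μ := by
  rw [integrable_matrix_iff] at hM ⊢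
  rintro (i | i) (j | j) <;> simp [dilation, hM]

lemma integral_dilation {M : Ω → Matrix (Fin d₁) (Fin d₂) ℝ} (hM : Integrable M μ) :
    ∫ ω, dilation (M ω) ∂μ = dilation (∫ ω, M ω ∂μ) := by
  ext (i | i) (j | j) <;> rw [integral_matrix_apply (integrable_dilation hM)] <;>
    simp [dilation, integral_matrix_apply hM]

lemma integrable_dilation_mul_self {M : Ω → Matrix (Fin d₁) (Fin d₂) ℝ}
    (h₁ : Integrable (fun ω => M ω * (M ω)ᵀ) μ) (h₂ : Integrable (fun ω => (M ω)ᵀ * M ω) μ) :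
    Integrable (fun ω => dilation (M ω) * dilation (M ω)) μ := by
  rw [integrable_matrix_iff] at h₁ h₂ ⊢
  simp only [dilation_mul_self]
  rintro (i | i) (j | j) <;> simp [h₁, h₂]

lemma integral_dilation_mul_self {M : Ω → Matrix (Fin d₁) (Fin d₂) ℝ}
    (h₁ : Integrable (fun ω => M ω * (M ω)ᵀ) μ) (h₂ : Integrable (fun ω => (M ω)ᵀ * M ω) μ) :
    ∫ ω, dilation (M ω) * dilation (M ω) ∂μ =
      fromBlocks (∫ ω, M ω * (M ω)ᵀ ∂μ) 0 0 (∫ ω, (M ω)ᵀ * M ω ∂μ) := by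
  ext (i | i) (j | j) <;> rw [integral_matrix_apply (integrable_dilation_mul_self h₁ h₂)] <;>
    simp only [dilation_mul_self, fromBlocks_apply₁₁, fromBlocks_apply₁₂, fromBlocks_apply₂₁,
      fromBlocks_apply₂₂, integral_matrix_apply h₁, integral_matrix_apply h₂, Matrix.zero_apply,
      integral_zero]

/-- Minsker's deviation inequality for the robust matrix mean of independent matrices that have a
common mean and uniformly bounded second moments. -/
theorem measure_norm_robustMean_sub_gt_le [IsProbabilityMeasure μ] {n : ℕ} (hn : 0 < n)
    {M : Fin n → Ω → Matrix (Fin d₁) (Fin d₂) ℝ} (hmeas : ∀ k, Measurable (M k))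
    (hindep : iIndepFun M μ) (hint : ∀ k, Integrable (M k) μ)
    (h₁ : ∀ k, Integrable (fun ω => M k ω * (M k ω)ᵀ) μ)
    (h₂ : ∀ k, Integrable (fun ω => (M k ω)ᵀ * M k ω) μ) {D : Matrix (Fin d₁) (Fin d₂) ℝ}
    (hmean : ∀ k, ∫ ω, M k ω ∂μ = D) {v : ℝ} (hv₁ : ∀ k, ∫ ω, M k ω * (M k ω)ᵀ ∂μ ≤ v • 1)
    (hv₂ : ∀ k, ∫ ω, (M k ω)ᵀ * M k ω ∂μ ≤ v • 1) {ν c : ℝ} (hν : 0 < ν) (hc : 0 ≤ c) :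
    μ {ω | c / (n * ν) < ‖robustMean ν (fun k => M k ω) - D‖} ≤
      ENNReal.ofReal ((d₁ + d₂) * Real.exp (n * (ν ^ 2 * v / 2) - c)) := by
  set G : Fin n → Ω → Matrix (Fin d₁ ⊕ Fin d₂) (Fin d₁ ⊕ Fin d₂) ℝ :=
    fun k ω => cfc phi (ν • dilation (M k ω)) with hG
  set C : Matrix (Fin d₁ ⊕ Fin d₂) (Fin d₁ ⊕ Fin d₂) ℝ :=
    ν • dilation D + (ν ^ 2 * v / 2) • 1 with hC
  have hsymm : ∀ k ω, (ν • dilation (M k ω)).IsHermitian := fun k ω => by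
    rw [← dilation_smul]
    exact isHermitian_dilation _
  have hDsymm : (ν • dilation D).IsHermitian := by
    rw [← dilation_smul]
    exact isHermitian_dilation _
  have hKsymm : (-((n * ν) • dilation D)).IsHermitian := by
    rw [← dilation_smul]
    exact (isHermitian_dilation _).neg
  have hcont : Continuous fun A : Matrix (Fin d₁) (Fin d₂) ℝ => ν • dilation A :=
    continuous_dilation.const_smul ν
  have hGmeas : ∀ k, Measurable (G k) := fun k =>
    measurable_cfc continuous_phi (hcont.measurable.comp (hmeas k)) (hsymm k)
  have hGindep : iIndepFun G μ := by
    have hf : Measurable fun A : Matrix (Fin d₁) (Fin d₂) ℝ => cfc phi (ν • dilation A) :=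
      measurable_cfc continuous_phi hcont.measurable fun A => by
        rw [← dilation_smul]
        exact isHermitian_dilation _
    exact hindep.comp (fun _ A => cfc phi (ν • dilation A)) fun _ => hf
  have hle : ∀ k, ∀ K : Matrix (Fin d₁ ⊕ Fin d₂) (Fin d₁ ⊕ Fin d₂) ℝ, K.IsHermitian →
      ∫⁻ ω, ENNReal.ofReal (trexp (K + G k ω)) ∂μ ≤ ENNReal.ofReal (trexp (K + C)) := by
    intro k K hK
    have e : ∀ ω, ν • dilation (M k ω) * ν • dilation (M k ω) =
        (ν ^ 2) • (dilation (M k ω) * dilation (M k ω)) := fun ω => by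
      rw [Matrix.smul_mul, Matrix.mul_smul, smul_smul, sq]
    refine lintegral_trexp_add_phi_le hK (hsymm k) (w := ν ^ 2 * v)
      ((integrable_dilation (hint k)).smul ν) ?_ ?_ ?_ hDsymm
    · simp only [e]
      exact (integrable_dilation_mul_self (h₁ k) (h₂ k)).smul (ν ^ 2)
    · rw [integral_smul, integral_dilation (hint k), hmean k]
    · simp only [e]
      rw [integral_smul, integral_dilation_mul_self (h₁ k) (h₂ k), mul_smul]
      exact smul_le_smul_matrix (fromBlocks_diagonal_le (hv₁ k) (hv₂ k)) (sq_nonneg ν)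
  have hsum := lintegral_trexp_sum_le hGmeas (fun k ω => isHermitian_cfc _ _)
    (C := fun _ => C) (fun _ => hDsymm.add (isHermitian_one.smul (by simp [IsSelfAdjoint])))
    hGindep hle Finset.univ hKsymm
  have hK : -((n * ν) • dilation D) + ∑ _k : Fin n, C = (n * (ν ^ 2 * v / 2)) • 1 := by
    rw [Finset.sum_const, Finset.card_univ, Fintype.card_fin, hC, ← Nat.cast_smul_eq_nsmul ℝ,
      smul_add, smul_smul, smul_smul]
    abel
  rw [hK, trexp_smul_one, Fintype.card_sum, Fintype.card_fin, Fintype.card_fin] at hsum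
  have hSmeas : Measurable fun ω =>
      ENNReal.ofReal (trexp (-((n * ν) • dilation D) + ∑ k, G k ω)) := by
    refine (continuous_trexp.measurable.comp ?_).ennreal_ofReal
    exact (Finset.measurable_sum _ fun k _ => hGmeas k).const_add _
  calc μ {ω | c / (n * ν) < ‖robustMean ν (fun k => M k ω) - D‖}
      ≤ μ {ω | ENNReal.ofReal (Real.exp c) ≤
          ENNReal.ofReal (trexp (-((n * ν) • dilation D) + ∑ k, G k ω))} := by
        refine measure_mono fun ω hω => ENNReal.ofReal_le_ofReal ?_
        by_contra hcon
        exact (not_le.2 hω) (norm_robustMean_sub_le hn hν hc _ D (not_le.1 hcon).le)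
    _ ≤ (∫⁻ ω, ENNReal.ofReal (trexp (-((n * ν) • dilation D) + ∑ k, G k ω)) ∂μ) /
          ENNReal.ofReal (Real.exp c) :=
        meas_ge_le_lintegral_div hSmeas.aemeasurable (by simp [Real.exp_pos]) ENNReal.ofReal_ne_top
    _ ≤ ENNReal.ofReal (((d₁ + d₂ : ℕ) : ℝ) * Real.exp (n * (ν ^ 2 * v / 2))) /
          ENNReal.ofReal (Real.exp c) := by gcongr
    _ = _ := by
        rw [← ENNReal.ofReal_div_of_pos (Real.exp_pos c), Real.exp_sub, mul_div_assoc]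
        push_cast
        rfl

end Tail

/-! ### Moments of conditionally sub-Gaussian noise -/

section CondSubgaussian

variable {Ω E : Type*} [MeasurableSpace Ω] [MeasurableSpace E] {μ : Measure Ω}
  {η : Ω → ℝ} {X : Ω → E} {σ : ℝ}

lemma two_add_sq_le_exp_add_exp (y : ℝ) : 2 + y ^ 2 ≤ Real.exp y + Real.exp (-y) := by
  have h1 : Real.exp y + Real.exp (-y) = 2 * Real.cosh y := by
    rw [Real.cosh_eq]
    ring
  have h2 : Real.cosh y = 1 + 2 * Real.sinh (y / 2) ^ 2 := by
    have h3 := Real.cosh_two_mul (y / 2)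
    have h4 := Real.cosh_sq (y / 2)
    rw [mul_div_cancel₀ y two_ne_zero] at h3
    rw [h3, h4]
    ring
  have h5 : (y / 2) ^ 2 ≤ Real.sinh (y / 2) ^ 2 := by
    rw [sq_le_sq]
    rcases le_total 0 (y / 2) with h | h
    · rw [abs_of_nonneg h, abs_of_nonneg (Real.sinh_nonneg_iff.2 h)]
      exact Real.self_le_sinh_iff.2 h
    · rw [abs_of_nonpos h, abs_of_nonpos (Real.sinh_nonpos_iff.2 h)]
      exact neg_le_neg (Real.sinh_le_self_iff.2 h)
  linarith

lemma exp_sub_one_le (x : ℝ) : Real.exp x - 1 ≤ x * Real.exp x := by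
  have h1 := Real.add_one_le_exp (-x)
  have h2 := mul_le_mul_of_nonneg_right h1 (Real.exp_pos x).le
  rw [← Real.exp_add, neg_add_cancel, Real.exp_zero] at h2
  linarith

lemma CondSubgaussian.integrable_sq (h : CondSubgaussian μ η X σ) (hη : Measurable η) :
    Integrable (fun ω => η ω ^ 2) μ := by
  refine ((h 1).1.add (h (-1)).1).mono' (hη.pow_const 2).aestronglyMeasurable
    (Filter.Eventually.of_forall fun ω => ?_)
  have := two_add_sq_le_exp_add_exp (η ω)
  rw [Real.norm_of_nonneg (sq_nonneg _), Pi.add_apply, one_mul, neg_one_mul]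
  linarith

lemma CondSubgaussian.memLp_two (h : CondSubgaussian μ η X σ) (hη : Measurable η) :
    MemLp η 2 μ :=
  (memLp_two_iff_integrable_sq hη.aestronglyMeasurable).2 (h.integrable_sq hη)

variable [IsProbabilityMeasure μ]

lemma CondSubgaussian.setIntegral_exp_le (h : CondSubgaussian μ η X σ) (hX : Measurable X) (s : ℝ)
    {U : Set E} (hU : MeasurableSet U) :
    ∫ ω in X ⁻¹' U, Real.exp (s * η ω) ∂μ ≤
      Real.exp (σ ^ 2 * s ^ 2 / 2) * μ.real (X ⁻¹' U) := by
  obtain ⟨h1, h2⟩ := h s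
  rw [← setIntegral_condExp hX.comap_le h1 ⟨U, hU, rfl⟩]
  calc _ ≤ ∫ _ω in X ⁻¹' U, Real.exp (σ ^ 2 * s ^ 2 / 2) ∂μ :=
        integral_mono_ae integrable_condExp.integrableOn (integrable_const _)
          (ae_restrict_of_ae h2)
    _ = _ := by rw [setIntegral_const, smul_eq_mul, mul_comm]

lemma CondSubgaussian.integrable (h : CondSubgaussian μ η X σ) (hη : Measurable η) :
    Integrable η μ :=
  (h.memLp_two hη).integrable one_le_two

/-- Second-order expansion of the moment generating function at `0`. -/
lemma CondSubgaussian.setIntegral_sq_le (h : CondSubgaussian μ η X σ) (hX : Measurable X)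
    (hη : Measurable η) {U : Set E} (hU : MeasurableSet U) :
    ∫ ω in X ⁻¹' U, η ω ^ 2 ∂μ ≤ σ ^ 2 * μ.real (X ⁻¹' U) := by
  have key : ∀ s : ℝ, s ≠ 0 → ∫ ω in X ⁻¹' U, η ω ^ 2 ∂μ ≤
      σ ^ 2 * Real.exp (σ ^ 2 * s ^ 2 / 2) * μ.real (X ⁻¹' U) := by
    intro s hs
    have h1 := h.setIntegral_exp_le hX s hU
    have h2 := h.setIntegral_exp_le hX (-s) hU
    rw [neg_sq] at h2
    have h3 : ∫ ω in X ⁻¹' U, (2 + s ^ 2 * η ω ^ 2) ∂μ ≤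
        ∫ ω in X ⁻¹' U, (Real.exp (s * η ω) + Real.exp (-s * η ω)) ∂μ := by
      refine integral_mono_ae ((integrable_const _).add
          ((h.integrable_sq hη).integrableOn.const_mul _))
        ((h s).1.integrableOn.add (h (-s)).1.integrableOn)
        (Filter.Eventually.of_forall fun ω => ?_)
      have := two_add_sq_le_exp_add_exp (s * η ω)
      simp only [neg_mul]
      linarith [mul_pow s (η ω) 2]
    rw [integral_add (integrable_const _) ((h.integrable_sq hη).integrableOn.const_mul _),
      integral_add (h s).1.integrableOn (h (-s)).1.integrableOn, setIntegral_const,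
      integral_const_mul, smul_eq_mul] at h3
    have h4 := mul_le_mul_of_nonneg_right (exp_sub_one_le (σ ^ 2 * s ^ 2 / 2))
      (measureReal_nonneg (μ := μ) (s := X ⁻¹' U))
    have hs2 : 0 < s ^ 2 := by positivity
    refine le_of_mul_le_mul_left ?_ hs2
    linarith
  have hcont : Continuous fun s : ℝ =>
      σ ^ 2 * Real.exp (σ ^ 2 * s ^ 2 / 2) * μ.real (X ⁻¹' U) := by fun_prop
  -- the bound at `s ≠ 0` passes to the limit `s → 0`
  have hlim := (hcont.tendsto 0).mono_left (nhdsWithin_le_nhds (s := {0}ᶜ))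
  have := ge_of_tendsto hlim (eventually_mem_nhdsWithin.mono fun s hs => key s hs)
  simpa using this

/-- First-order expansion of the moment generating function at `0`. -/
lemma CondSubgaussian.setIntegral_eq_zero (h : CondSubgaussian μ η X σ) (hX : Measurable X)
    (hη : Measurable η) {U : Set E} (hU : MeasurableSet U) :
    ∫ ω in X ⁻¹' U, η ω ∂μ = 0 := by
  set I := ∫ ω in X ⁻¹' U, η ω ∂μ with hI
  set p := μ.real (X ⁻¹' U) with hp
  have key : ∀ s : ℝ, s * I ≤ s * (s * (σ ^ 2 / 2 * Real.exp (σ ^ 2 * s ^ 2 / 2) * p)) := by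
    intro s
    have h1 := h.setIntegral_exp_le hX s hU
    have h3 : ∫ ω in X ⁻¹' U, (1 + s * η ω) ∂μ ≤ ∫ ω in X ⁻¹' U, Real.exp (s * η ω) ∂μ := by
      refine integral_mono_ae ((integrable_const _).add
          ((h.integrable hη).integrableOn.const_mul _)) (h s).1.integrableOn
        (Filter.Eventually.of_forall fun ω => ?_)
      have := Real.add_one_le_exp (s * η ω)
      simp only
      linarith
    rw [integral_add (integrable_const _) ((h.integrable hη).integrableOn.const_mul _),
      setIntegral_const, integral_const_mul, smul_eq_mul, ← hI, ← hp] at h3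
    have h4 := mul_le_mul_of_nonneg_right (exp_sub_one_le (σ ^ 2 * s ^ 2 / 2))
      (measureReal_nonneg (μ := μ) (s := X ⁻¹' U))
    rw [← hp] at h4 h1
    linarith
  have hcont : Continuous fun s : ℝ =>
      s * (σ ^ 2 / 2 * Real.exp (σ ^ 2 * s ^ 2 / 2) * p) := by fun_prop
  have hlim := hcont.tendsto 0
  rw [zero_mul] at hlim
  -- dividing by `s > 0` gives the upper bound as `s → 0`, dividing by `s < 0` the lower bound
  refine le_antisymm ?_ ?_
  · exact ge_of_tendsto (hlim.mono_left (nhdsWithin_le_nhds (s := Set.Ioi 0)))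
      (eventually_mem_nhdsWithin.mono fun s hs => le_of_mul_le_mul_left (key s) hs)
  · refine le_of_tendsto (hlim.mono_left (nhdsWithin_le_nhds (s := Set.Iio 0)))
      (eventually_mem_nhdsWithin.mono fun s hs => ?_)
    exact (mul_le_mul_left_of_neg hs).1 (key s)

lemma CondSubgaussian.condExp_eq_zero (h : CondSubgaussian μ η X σ) (hX : Measurable X)
    (hη : Measurable η) :
    μ[η | MeasurableSpace.comap X inferInstance] =ᵐ[μ] 0 := by
  refine (ae_eq_condExp_of_forall_setIntegral_eq hX.comap_le (h.integrable hη)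
    (fun s _ _ => integrableOn_zero) ?_ aestronglyMeasurable_zero).symm
  rintro s ⟨U, hU, rfl⟩ _
  rw [h.setIntegral_eq_zero hX hη hU]
  simp

lemma CondSubgaussian.integral_mul_eq_zero (h : CondSubgaussian μ η X σ) (hX : Measurable X)
    (hη : Measurable η) {g : E → ℝ} (hg : Measurable g)
    (hint : Integrable (fun ω => g (X ω) * η ω) μ) : ∫ ω, g (X ω) * η ω ∂μ = 0 := by
  have hgm : StronglyMeasurable[MeasurableSpace.comap X inferInstance] (fun ω => g (X ω)) :=
    (hg.comp (comap_measurable X)).stronglyMeasurable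
  rw [← integral_condExp hX.comap_le]
  refine integral_eq_zero_of_ae ?_
  have h1 := condExp_mul_of_stronglyMeasurable_left hgm hint (h.integrable hη)
  filter_upwards [h1, h.condExp_eq_zero hX hη] with ω h2 h3
  refine h2.trans ?_
  rw [Pi.mul_apply, h3]
  simp

/-- The second-moment bound weighted by a nonnegative function of the conditioning variable. -/
lemma CondSubgaussian.lintegral_mul_sq_le (h : CondSubgaussian μ η X σ) (hX : Measurable X)
    (hη : Measurable η) {g : E → ENNReal} (hg : Measurable g) :
    ∫⁻ ω, ENNReal.ofReal (η ω ^ 2) * g (X ω) ∂μ ≤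
      ENNReal.ofReal (σ ^ 2) * ∫⁻ x, g x ∂(μ.map X) := by
  have hη2 : Measurable fun ω => ENNReal.ofReal (η ω ^ 2) := (hη.pow_const 2).ennreal_ofReal
  -- `setIntegral_sq_le` compares measures on the range of `X`
  have hle : (μ.withDensity fun ω => ENNReal.ofReal (η ω ^ 2)).map X ≤
      ENNReal.ofReal (σ ^ 2) • μ.map X := by
    refine Measure.le_iff.2 fun U hU => ?_
    rw [Measure.map_apply hX hU, withDensity_apply _ (hX hU), Measure.smul_apply,
      Measure.map_apply hX hU, smul_eq_mul,
      ← ofReal_integral_eq_lintegral_ofReal (h.integrable_sq hη).integrableOn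
        (Filter.Eventually.of_forall fun ω => sq_nonneg _),
      ← ofReal_measureReal (μ := μ) (s := X ⁻¹' U), ← ENNReal.ofReal_mul (sq_nonneg σ)]
    exact ENNReal.ofReal_le_ofReal (h.setIntegral_sq_le hX hη hU)
  calc ∫⁻ ω, ENNReal.ofReal (η ω ^ 2) * g (X ω) ∂μ
      = ∫⁻ x, g x ∂((μ.withDensity fun ω => ENNReal.ofReal (η ω ^ 2)).map X) := by
        rw [lintegral_map hg hX]
        exact (lintegral_withDensity_eq_lintegral_mul _ hη2 (hg.comp hX)).symm
    _ ≤ ∫⁻ x, g x ∂(ENNReal.ofReal (σ ^ 2) • μ.map X) := lintegral_mono' hle le_rfl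
    _ = _ := by rw [lintegral_smul_measure, smul_eq_mul]

lemma CondSubgaussian.integrable_sq_mul (h : CondSubgaussian μ η X σ) (hX : Measurable X)
    (hη : Measurable η) {g : E → ℝ} (hg : Measurable g) (hgi : Integrable g (μ.map X)) :
    Integrable (fun ω => η ω ^ 2 * g (X ω)) μ := by
  refine ⟨((hη.pow_const 2).mul (hg.comp hX)).aestronglyMeasurable, ?_⟩
  have h1 := h.lintegral_mul_sq_le hX hη hg.enorm
  rw [HasFiniteIntegral]
  refine (le_trans (le_of_eq (lintegral_congr fun ω => ?_)) h1).trans_lt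
    (ENNReal.mul_lt_top ENNReal.ofReal_lt_top hgi.2)
  rw [enorm_mul, Real.enorm_of_nonneg (sq_nonneg _)]

lemma CondSubgaussian.integral_sq_mul_le (h : CondSubgaussian μ η X σ) (hX : Measurable X)
    (hη : Measurable η) {g : E → ℝ} (hg : Measurable g) (hgi : Integrable g (μ.map X))
    (hg0 : ∀ x, 0 ≤ g x) :
    ∫ ω, η ω ^ 2 * g (X ω) ∂μ ≤ σ ^ 2 * ∫ x, g x ∂(μ.map X) := by
  have h1 := h.lintegral_mul_sq_le hX hη hg.ennreal_ofReal
  have hI : 0 ≤ ∫ x, g x ∂(μ.map X) := integral_nonneg hg0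
  rw [← ENNReal.ofReal_le_ofReal_iff (by positivity), ENNReal.ofReal_mul (sq_nonneg σ),
    ofReal_integral_eq_lintegral_ofReal hgi (Filter.Eventually.of_forall hg0),
    ofReal_integral_eq_lintegral_ofReal (h.integrable_sq_mul hX hη hg hgi)
      (Filter.Eventually.of_forall fun ω => mul_nonneg (sq_nonneg _) (hg0 _))]
  refine le_trans (le_of_eq (lintegral_congr fun ω => ?_)) h1
  rw [ENNReal.ofReal_mul (sq_nonneg _)]

end CondSubgaussian

/-! ### Moments of the one-sample estimates -/

section Design

open scoped MatrixOrder

variable {d₁ d₂ : ℕ} {π : Measure (Matrix (Fin d₁) (Fin d₂) ℝ)}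

lemma measurable_vec (p : Fin d₂ × Fin d₁) :
    Measurable fun A : Matrix (Fin d₁) (Fin d₂) ℝ => A.vec p := by
  have : Continuous fun A : Matrix (Fin d₁) (Fin d₂) ℝ => A p.2 p.1 := by fun_prop
  exact this.measurable

lemma measurable_dotProduct_vec (a : Fin d₂ × Fin d₁ → ℝ) :
    Measurable fun A : Matrix (Fin d₁) (Fin d₂) ℝ => a ⬝ᵥ A.vec :=
  Finset.measurable_sum _ fun p _ => (measurable_vec p).const_mul _

lemma integrable_vec_mul_vec (hπ2 : Integrable (fun A => ‖A‖ ^ 2) π) (p q : Fin d₂ × Fin d₁) :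
    Integrable (fun A : Matrix (Fin d₁) (Fin d₂) ℝ => A.vec p * A.vec q) π := by
  have hb : ∀ (p : Fin d₂ × Fin d₁) (A : Matrix (Fin d₁) (Fin d₂) ℝ),
      ‖A.vec p‖ ≤ ‖entryCLM (m := Fin d₁) (n := Fin d₂) p.2 p.1‖ * ‖A‖ := fun p A =>
    (entryCLM p.2 p.1).le_opNorm A
  refine (hπ2.const_mul (‖entryCLM (m := Fin d₁) (n := Fin d₂) p.2 p.1‖ *
    ‖entryCLM (m := Fin d₁) (n := Fin d₂) q.2 q.1‖)).mono'
    ((measurable_vec p).mul (measurable_vec q)).aestronglyMeasurable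
    (Filter.Eventually.of_forall fun A => ?_)
  rw [norm_mul]
  calc _ ≤ (‖entryCLM (m := Fin d₁) (n := Fin d₂) p.2 p.1‖ * ‖A‖) *
        (‖entryCLM (m := Fin d₁) (n := Fin d₂) q.2 q.1‖ * ‖A‖) := by
        gcongr
        · exact hb p A
        · exact hb q A
    _ = _ := by ring

lemma integrable_dotProduct_mul_dotProduct (hπ2 : Integrable (fun A => ‖A‖ ^ 2) π)
    (a b : Fin d₂ × Fin d₁ → ℝ) :
    Integrable (fun A : Matrix (Fin d₁) (Fin d₂) ℝ => (a ⬝ᵥ A.vec) * (b ⬝ᵥ A.vec)) π := by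
  have e : (fun A : Matrix (Fin d₁) (Fin d₂) ℝ => (a ⬝ᵥ A.vec) * (b ⬝ᵥ A.vec)) =
      fun A => ∑ p, ∑ q, (a p * b q) * (A.vec p * A.vec q) := by
    funext A
    simp only [dotProduct, Finset.sum_mul_sum]
    exact Finset.sum_congr rfl fun p _ => Finset.sum_congr rfl fun q _ => by ring
  rw [e]
  exact integrable_finsetSum _ fun p _ => integrable_finsetSum _ fun q _ =>
    (integrable_vec_mul_vec hπ2 p q).const_mul _

lemma integral_dotProduct_mul_dotProduct (hπ2 : Integrable (fun A => ‖A‖ ^ 2) π)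
    (a b : Fin d₂ × Fin d₁ → ℝ) :
    ∫ A, (a ⬝ᵥ A.vec) * (b ⬝ᵥ A.vec) ∂π = a ⬝ᵥ (designCov π *ᵥ b) := by
  have e : ∀ A : Matrix (Fin d₁) (Fin d₂) ℝ, (a ⬝ᵥ A.vec) * (b ⬝ᵥ A.vec) =
      ∑ p, ∑ q, (a p * b q) * (A.vec p * A.vec q) := by
    intro A
    simp only [dotProduct, Finset.sum_mul_sum]
    exact Finset.sum_congr rfl fun p _ => Finset.sum_congr rfl fun q _ => by ring
  simp only [e]
  rw [integral_finsetSum _ fun p _ => integrable_finsetSum _ fun q _ =>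
    (integrable_vec_mul_vec hπ2 p q).const_mul _]
  simp only [dotProduct, mulVec, Finset.mul_sum]
  refine Finset.sum_congr rfl fun p _ => ?_
  rw [integral_finsetSum _ fun q _ => (integrable_vec_mul_vec hπ2 p q).const_mul _]
  refine Finset.sum_congr rfl fun q _ => ?_
  rw [integral_const_mul, designCov, of_apply]
  ring

lemma posDef_designCov (hπ2 : Integrable (fun A => ‖A‖ ^ 2) π) (hQ : IsUnit (designCov π)) :
    (designCov π).PosDef := by
  refine (PosSemidef.posDef_iff_isUnit ?_).2 hQ
  refine PosSemidef.of_dotProduct_mulVec_nonneg ?_ fun a => ?_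
  · ext p q
    simp only [conjTranspose_apply, designCov, of_apply, star_trivial]
    exact integral_congr_ae (Filter.Eventually.of_forall fun A => mul_comm _ _)
  · rw [star_trivial, ← integral_dotProduct_mul_dotProduct hπ2]
    exact integral_nonneg fun A => mul_self_nonneg _

/-- The matrix `reshape (Q⁻¹ vec A)`: the one-sample estimate for a unit residual. -/
noncomputable def whiten (Q : Matrix (Fin d₂ × Fin d₁) (Fin d₂ × Fin d₁) ℝ)
    (A : Matrix (Fin d₁) (Fin d₂) ℝ) : Matrix (Fin d₁) (Fin d₂) ℝ :=
  reshape (Q⁻¹ *ᵥ A.vec)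

lemma whiten_apply (Q : Matrix (Fin d₂ × Fin d₁) (Fin d₂ × Fin d₁) ℝ)
    (A : Matrix (Fin d₁) (Fin d₂) ℝ) (i : Fin d₁) (j : Fin d₂) :
    whiten Q A i j = Q⁻¹ (j, i) ⬝ᵥ A.vec := rfl

lemma oneSample_eq_smul_whiten (Q : Matrix (Fin d₂ × Fin d₁) (Fin d₂ × Fin d₁) ℝ)
    (Θ₀ A : Matrix (Fin d₁) (Fin d₂) ℝ) (y : ℝ) :
    oneSample Q Θ₀ A y = (y - matInner Θ₀ A) • whiten Q A := by
  rw [oneSample, mulVec_smul]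
  rfl

lemma matInner_eq_dotProduct (A C : Matrix (Fin d₁) (Fin d₂) ℝ) :
    matInner A C = A.vec ⬝ᵥ C.vec := by
  rw [vec_dotProduct_vec, matInner]

lemma integrable_whiten_mul_whiten (hπ2 : Integrable (fun A => ‖A‖ ^ 2) π)
    (Q : Matrix (Fin d₂ × Fin d₁) (Fin d₂ × Fin d₁) ℝ) (i k : Fin d₁) (j l : Fin d₂) :
    Integrable (fun A => whiten Q A i j * whiten Q A k l) π :=
  integrable_dotProduct_mul_dotProduct hπ2 _ _

lemma integral_whiten_mul_whiten (hπ2 : Integrable (fun A => ‖A‖ ^ 2) π)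
    (hQ : IsUnit (designCov π)) (i k : Fin d₁) (j l : Fin d₂) :
    ∫ A, whiten (designCov π) A i j * whiten (designCov π) A k l ∂π =
      (designCov π)⁻¹ (j, i) (l, k) := by
  simp only [whiten_apply]
  rw [integral_dotProduct_mul_dotProduct hπ2]
  have hdet := (isUnit_iff_isUnit_det _).1 hQ
  have hsymm := (posDef_designCov hπ2 hQ).isHermitian.inv
  have h1 : (designCov π)⁻¹ (l, k) = fun q => (designCov π)⁻¹ q (l, k) := by
    funext q
    conv_rhs => rw [← hsymm.apply]
    simp
  have h2 : designCov π *ᵥ (designCov π)⁻¹ (l, k) = Pi.single (l, k) 1 := by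
    rw [h1]
    funext q
    change (designCov π * (designCov π)⁻¹) q (l, k) = _
    rw [mul_nonsing_inv _ hdet, Matrix.one_apply, Pi.single_apply]
  rw [h2, dotProduct_single, mul_one]

lemma integral_inner_mul_whiten (hπ2 : Integrable (fun A => ‖A‖ ^ 2) π)
    (hQ : IsUnit (designCov π)) (D : Matrix (Fin d₁) (Fin d₂) ℝ) (i : Fin d₁) (j : Fin d₂) :
    ∫ A, matInner D A * whiten (designCov π) A i j ∂π = D i j := by
  simp only [whiten_apply, matInner_eq_dotProduct]
  have hdet := (isUnit_iff_isUnit_det _).1 hQ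
  have h0 : ∀ A : Matrix (Fin d₁) (Fin d₂) ℝ, (D.vec ⬝ᵥ A.vec) * ((designCov π)⁻¹ (j, i) ⬝ᵥ A.vec) =
      ((designCov π)⁻¹ (j, i) ⬝ᵥ A.vec) * (D.vec ⬝ᵥ A.vec) := fun A => mul_comm _ _
  simp only [h0]
  rw [integral_dotProduct_mul_dotProduct hπ2]
  change ((designCov π)⁻¹ *ᵥ (designCov π *ᵥ D.vec)) (j, i) = D i j
  rw [mulVec_mulVec, nonsing_inv_mul _ hdet, one_mulVec]
  rfl

lemma measurable_whiten (Q : Matrix (Fin d₂ × Fin d₁) (Fin d₂ × Fin d₁) ℝ) :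
    Measurable (whiten Q) :=
  measurable_pi_lambda _ fun i => measurable_pi_lambda _ fun j =>
    measurable_dotProduct_vec (Q⁻¹ (j, i))

lemma integrable_whiten_mul_transpose (hπ2 : Integrable (fun A => ‖A‖ ^ 2) π)
    (Q : Matrix (Fin d₂ × Fin d₁) (Fin d₂ × Fin d₁) ℝ) :
    Integrable (fun A => whiten Q A * (whiten Q A)ᵀ) π := by
  refine integrable_matrix_iff.2 fun i k => ?_
  simp only [mul_apply, transpose_apply]
  exact integrable_finsetSum _ fun j _ => integrable_whiten_mul_whiten hπ2 Q i k j j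

lemma integrable_transpose_whiten_mul (hπ2 : Integrable (fun A => ‖A‖ ^ 2) π)
    (Q : Matrix (Fin d₂ × Fin d₁) (Fin d₂ × Fin d₁) ℝ) :
    Integrable (fun A => (whiten Q A)ᵀ * whiten Q A) π := by
  refine integrable_matrix_iff.2 fun j l => ?_
  simp only [mul_apply, transpose_apply]
  exact integrable_finsetSum _ fun i _ => integrable_whiten_mul_whiten hπ2 Q i i j l

lemma integral_whiten_mul_transpose (hπ2 : Integrable (fun A => ‖A‖ ^ 2) π)
    (hQ : IsUnit (designCov π)) :
    ∫ A, whiten (designCov π) A * (whiten (designCov π) A)ᵀ ∂π = ∑ j, Dcol (designCov π) j := by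
  ext i k
  rw [integral_matrix_apply (integrable_whiten_mul_transpose hπ2 _), Matrix.sum_apply]
  simp only [mul_apply, transpose_apply]
  rw [integral_finsetSum _ fun j _ => integrable_whiten_mul_whiten hπ2 _ i k j j]
  exact Finset.sum_congr rfl fun j _ => integral_whiten_mul_whiten hπ2 hQ i k j j

lemma integral_transpose_whiten_mul (hπ2 : Integrable (fun A => ‖A‖ ^ 2) π)
    (hQ : IsUnit (designCov π)) :
    ∫ A, (whiten (designCov π) A)ᵀ * whiten (designCov π) A ∂π = ∑ i, Drow (designCov π) i := by
  ext j l
  rw [integral_matrix_apply (integrable_transpose_whiten_mul hπ2 _), Matrix.sum_apply]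
  simp only [mul_apply, transpose_apply]
  rw [integral_finsetSum _ fun i _ => integrable_whiten_mul_whiten hπ2 _ i i j l]
  exact Finset.sum_congr rfl fun i _ => integral_whiten_mul_whiten hπ2 hQ i i j l

lemma le_lambdaMax {n : ℕ} {A : Matrix (Fin n) (Fin n) ℝ} (hA : A.IsHermitian) :
    A ≤ lambdaMax A • 1 :=
  (le_smul_one_iff hA).2 fun _ hx => le_csSup (finite_real_spectrum (A := A)).bddAbove hx

lemma isHermitian_sum_Dcol {Q : Matrix (Fin d₂ × Fin d₁) (Fin d₂ × Fin d₁) ℝ}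
    (hQ : Q.PosDef) : (∑ j, Dcol Q j).IsHermitian :=
  (posSemidef_sum _ fun j _ => hQ.inv.posSemidef.submatrix fun i => (j, i)).isHermitian

lemma isHermitian_sum_Drow {Q : Matrix (Fin d₂ × Fin d₁) (Fin d₂ × Fin d₁) ℝ}
    (hQ : Q.PosDef) : (∑ i, Drow Q i).IsHermitian :=
  (posSemidef_sum _ fun i _ => hQ.inv.posSemidef.submatrix fun j => (j, i)).isHermitian

lemma smul_one_mono {n : Type*} [DecidableEq n] [Fintype n] {a b : ℝ} (h : a ≤ b) :
    a • (1 : Matrix n n ℝ) ≤ b • 1 := by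
  rw [le_iff, ← sub_smul]
  exact PosSemidef.one.smul (sub_nonneg.2 h)

lemma sum_Dcol_le {Q : Matrix (Fin d₂ × Fin d₁) (Fin d₂ × Fin d₁) ℝ} (hQ : Q.PosDef) :
    ∑ j, Dcol Q j ≤ B Q • 1 :=
  le_trans (le_lambdaMax (isHermitian_sum_Dcol hQ)) (smul_one_mono (le_max_left _ _))

lemma sum_Drow_le {Q : Matrix (Fin d₂ × Fin d₁) (Fin d₂ × Fin d₁) ℝ} (hQ : Q.PosDef) :
    ∑ i, Drow Q i ≤ B Q • 1 :=
  le_trans (le_lambdaMax (isHermitian_sum_Drow hQ)) (smul_one_mono (le_max_right _ _))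

lemma B_pos (hd₁ : 0 < d₁) (hd₂ : 0 < d₂)
    {Q : Matrix (Fin d₂ × Fin d₁) (Fin d₂ × Fin d₁) ℝ} (hQ : Q.PosDef) : 0 < B Q := by
  have h1 := (le_iff.1 (sum_Dcol_le hQ)).diag_nonneg (i := ⟨0, hd₁⟩)
  rw [Matrix.sub_apply, Matrix.smul_apply, Matrix.one_apply_eq, smul_eq_mul, mul_one,
    Matrix.sum_apply] at h1
  have h2 : 0 < ∑ j, Dcol Q j ⟨0, hd₁⟩ ⟨0, hd₁⟩ := by
    have : Nonempty (Fin d₂) := ⟨⟨0, hd₂⟩⟩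
    exact Finset.sum_pos (fun j _ => hQ.inv.diag_pos) Finset.univ_nonempty
  linarith

end Design

section OneSample

open scoped MatrixOrder

variable {d₁ d₂ : ℕ} {π : Measure (Matrix (Fin d₁) (Fin d₂) ℝ)} {Ω : Type*} [MeasurableSpace Ω]
  {μ : Measure Ω} {X : Ω → Matrix (Fin d₁) (Fin d₂) ℝ} {η : Ω → ℝ}
  {σ R : ℝ} {c : Matrix (Fin d₁) (Fin d₂) ℝ → ℝ}

/-- The quadratic form of a fixed vector, as a continuous linear functional of the matrix. -/
noncomputable def quadCLM {m : Type} [Fintype m] [DecidableEq m] (u : m → ℝ) :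
    Matrix m m ℝ →L[ℝ] ℝ :=
  LinearMap.toContinuousLinearMap
    { toFun := fun A => u ⬝ᵥ (A *ᵥ u)
      map_add' := fun A C => by rw [add_mulVec, dotProduct_add]
      map_smul' := fun r A => by rw [smul_mulVec, dotProduct_smul]; rfl }

lemma quadCLM_apply {m : Type} [Fintype m] [DecidableEq m] (u : m → ℝ) (A : Matrix m m ℝ) :
    quadCLM u A = u ⬝ᵥ (A *ᵥ u) := rfl

lemma posSemidef_integral {m : Type} [Fintype m] [DecidableEq m] {P : Ω → Matrix m m ℝ}
    (hPi : Integrable P μ) (hP : ∀ ω, (P ω).PosSemidef) : (∫ ω, P ω ∂μ).PosSemidef := by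
  refine PosSemidef.of_dotProduct_mulVec_nonneg ?_ fun u => ?_
  · ext i j
    rw [conjTranspose_apply, integral_matrix_apply hPi, integral_matrix_apply hPi, star_trivial]
    exact integral_congr_ae (Filter.Eventually.of_forall fun ω => by
      simpa using (hP ω).isHermitian.apply i j)
  · rw [star_trivial, ← quadCLM_apply, ← (quadCLM u).integral_comp_comm hPi]
    exact integral_nonneg fun ω => (hP ω).dotProduct_mulVec_nonneg u

variable [IsProbabilityMeasure μ]

/-- With a bounded bias `c X` and sub-Gaussian noise `η`, the factor
`(c X + η)² ≤ 2 (c X)² + 2 η²` keeps integrable weights integrable. -/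
lemma integrable_residual_sq_mul (h : CondSubgaussian μ η X σ) (hX : Measurable X)
    (hη : Measurable η) (hXπ : μ.map X = π) (hc : Measurable c) (hcR : ∀ᵐ A ∂π, |c A| ≤ R)
    {g : Matrix (Fin d₁) (Fin d₂) ℝ → ℝ} (hg : Measurable g) (hgi : Integrable g π) :
    Integrable (fun ω => (c (X ω) + η ω) ^ 2 * g (X ω)) μ := by
  subst hXπ
  have h1 : Integrable (fun ω => |g (X ω)|) μ := (hgi.comp_measurable hX).abs
  have h2 := h.integrable_sq_mul hX hη hg.abs hgi.abs
  refine ((h1.const_mul (2 * R ^ 2)).add (h2.const_mul 2)).mono'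
    ((((hc.comp hX).add hη).pow_const 2).mul (hg.comp hX)).aestronglyMeasurable ?_
  filter_upwards [ae_of_ae_map hX.aemeasurable hcR] with ω hω
  rw [norm_mul, Real.norm_of_nonneg (sq_nonneg _), Real.norm_eq_abs, Pi.add_apply]
  have h3 : c (X ω) ^ 2 ≤ R ^ 2 := sq_le_sq.2 (hω.trans (le_abs_self R))
  have h4 : (c (X ω) + η ω) ^ 2 ≤ 2 * R ^ 2 + 2 * η ω ^ 2 := by
    nlinarith [sq_nonneg (c (X ω) - η ω)]
  have h5 := mul_le_mul_of_nonneg_right h4 (abs_nonneg (g (X ω)))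
  linarith

lemma integral_residual_sq_mul_le (h : CondSubgaussian μ η X σ) (hX : Measurable X)
    (hη : Measurable η) (hXπ : μ.map X = π) (hc : Measurable c) (hcR : ∀ᵐ A ∂π, |c A| ≤ R)
    {g : Matrix (Fin d₁) (Fin d₂) ℝ → ℝ} (hg : Measurable g) (hgi : Integrable g π)
    (hg0 : ∀ A, 0 ≤ g A) :
    ∫ ω, (c (X ω) + η ω) ^ 2 * g (X ω) ∂μ ≤ 2 * (σ ^ 2 + R ^ 2) * ∫ A, g A ∂π := by
  have h0 := integrable_residual_sq_mul h hX hη hXπ hc hcR hg hgi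
  subst hXπ
  have h1 : Integrable (fun ω => g (X ω)) μ := hgi.comp_measurable hX
  have h2 := h.integrable_sq_mul hX hη hg hgi
  have h3 := h.integral_sq_mul_le hX hη hg hgi hg0
  have h4 : ∫ ω, (c (X ω) + η ω) ^ 2 * g (X ω) ∂μ ≤
      ∫ ω, (2 * R ^ 2 * g (X ω) + 2 * (η ω ^ 2 * g (X ω))) ∂μ := by
    refine integral_mono_ae h0 ((h1.const_mul _).add (h2.const_mul _)) ?_
    filter_upwards [ae_of_ae_map hX.aemeasurable hcR] with ω hω
    have h3 : c (X ω) ^ 2 ≤ R ^ 2 := sq_le_sq.2 (hω.trans (le_abs_self R))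
    have h4 : (c (X ω) + η ω) ^ 2 ≤ 2 * R ^ 2 + 2 * η ω ^ 2 := by
      nlinarith [sq_nonneg (c (X ω) - η ω)]
    have h5 := mul_le_mul_of_nonneg_right h4 (hg0 (X ω))
    linarith
  rw [integral_add (h1.const_mul _) (h2.const_mul _), integral_const_mul, integral_const_mul,
    ← integral_map hX.aemeasurable hg.aestronglyMeasurable] at h4
  linarith

lemma integrable_residual_sq_smul {m : Type} [Fintype m] [DecidableEq m]
    (h : CondSubgaussian μ η X σ) (hX : Measurable X)
    (hη : Measurable η) (hXπ : μ.map X = π) (hc : Measurable c) (hcR : ∀ᵐ A ∂π, |c A| ≤ R)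
    {P : Matrix (Fin d₁) (Fin d₂) ℝ → Matrix m m ℝ} (hP : Measurable P) (hPi : Integrable P π) :
    Integrable (fun ω => (c (X ω) + η ω) ^ 2 • P (X ω)) μ := by
  refine integrable_matrix_iff.2 fun i j => ?_
  have hPij : Measurable fun A => P A i j := (entryCLM i j).continuous.measurable.comp hP
  exact integrable_residual_sq_mul h hX hη hXπ hc hcR hPij (integrable_matrix_iff.1 hPi i j)

/-- Second moments of the one-sample estimates are dominated by those of the whitened design. -/
lemma integral_residual_sq_smul_le {m : Type} [Fintype m] [DecidableEq m]
    (h : CondSubgaussian μ η X σ) (hX : Measurable X)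
    (hη : Measurable η) (hXπ : μ.map X = π) (hc : Measurable c) (hcR : ∀ᵐ A ∂π, |c A| ≤ R)
    {P : Matrix (Fin d₁) (Fin d₂) ℝ → Matrix m m ℝ} (hP : Measurable P) (hPi : Integrable P π)
    (hP0 : ∀ A, (P A).PosSemidef) {b : ℝ} (hb : ∫ A, P A ∂π ≤ b • 1) :
    ∫ ω, (c (X ω) + η ω) ^ 2 • P (X ω) ∂μ ≤ (2 * (σ ^ 2 + R ^ 2) * b) • 1 := by
  have hi := integrable_residual_sq_smul h hX hη hXπ hc hcR hP hPi
  have hps := posSemidef_integral hi fun ω => (hP0 (X ω)).smul (sq_nonneg (c (X ω) + η ω))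
  have hone : (2 * (σ ^ 2 + R ^ 2) * b) • (1 : Matrix m m ℝ) =
      (2 * (σ ^ 2 + R ^ 2)) • b • 1 := by rw [smul_smul]
  refine le_iff.2 (PosSemidef.of_dotProduct_mulVec_nonneg
    ((isHermitian_one.smul (by simp [IsSelfAdjoint])).sub hps.isHermitian) fun u => ?_)
  have hu : Measurable fun A => quadCLM u (P A) := (quadCLM u).continuous.measurable.comp hP
  have h1 := integral_residual_sq_mul_le h hX hη hXπ hc hcR hu ((quadCLM u).integrable_comp hPi)
    fun A => (hP0 A).dotProduct_mulVec_nonneg u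
  have h2 : ∫ ω, (c (X ω) + η ω) ^ 2 * quadCLM u (P (X ω)) ∂μ =
      quadCLM u (∫ ω, (c (X ω) + η ω) ^ 2 • P (X ω) ∂μ) := by
    rw [← (quadCLM u).integral_comp_comm hi]
    simp only [map_smul, smul_eq_mul]
  have h3 := (le_iff.1 hb).dotProduct_mulVec_nonneg u
  rw [star_trivial, ← quadCLM_apply, map_sub] at h3 ⊢
  rw [(quadCLM u).integral_comp_comm hPi, h2] at h1
  rw [hone, map_smul, smul_eq_mul]
  have h4 := mul_le_mul_of_nonneg_left h3 (show 0 ≤ 2 * (σ ^ 2 + R ^ 2) by positivity)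
  linarith

/-- The one-sample estimate is unbiased: a linear response `⟨D, X⟩ + η` has mean `D` after
whitening. -/
lemma integral_residual_smul_whiten (h : CondSubgaussian μ η X σ) (hX : Measurable X)
    (hη : Measurable η) (hXπ : μ.map X = π) (hπ2 : Integrable (fun A => ‖A‖ ^ 2) π)
    (hQ : IsUnit (designCov π)) (D : Matrix (Fin d₁) (Fin d₂) ℝ) :
    Integrable (fun ω => (matInner D (X ω) + η ω) • whiten (designCov π) (X ω)) μ ∧
      ∫ ω, (matInner D (X ω) + η ω) • whiten (designCov π) (X ω) ∂μ = D := by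
  have hw : ∀ i j, Measurable fun A => whiten (designCov π) A i j := fun i j =>
    measurable_dotProduct_vec _
  have hD : ∀ i j, Integrable (fun ω => matInner D (X ω) * whiten (designCov π) (X ω) i j) μ := by
    intro i j
    have : Integrable (fun A => matInner D A * whiten (designCov π) A i j) (μ.map X) := by
      rw [hXπ]
      simp only [whiten_apply, matInner_eq_dotProduct]
      exact integrable_dotProduct_mul_dotProduct hπ2 _ _
    exact this.comp_measurable hX
  have hN : ∀ i j, Integrable (fun ω => whiten (designCov π) (X ω) i j * η ω) μ := by
    intro i j
    have h1 : Integrable (fun A => whiten (designCov π) A i j ^ 2) (μ.map X) := by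
      rw [hXπ]
      simp only [whiten_apply, sq]
      exact integrable_dotProduct_mul_dotProduct hπ2 _ _
    have h2 : MemLp (fun ω => whiten (designCov π) (X ω) i j) 2 μ :=
      (memLp_two_iff_integrable_sq ((hw i j).comp hX).aestronglyMeasurable).2
        (h1.comp_measurable hX)
    exact h2.integrable_mul (h.memLp_two hη)
  have he : ∀ i j ω, ((matInner D (X ω) + η ω) • whiten (designCov π) (X ω)) i j =
      matInner D (X ω) * whiten (designCov π) (X ω) i j +
        whiten (designCov π) (X ω) i j * η ω := fun i j ω => by
    rw [Matrix.smul_apply, smul_eq_mul]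
    ring
  have hint : Integrable (fun ω => (matInner D (X ω) + η ω) • whiten (designCov π) (X ω)) μ := by
    refine integrable_matrix_iff.2 fun i j => ?_
    simp only [he]
    exact (hD i j).add (hN i j)
  refine ⟨hint, ?_⟩
  ext i j
  rw [integral_matrix_apply hint]
  simp only [he]
  rw [integral_add (hD i j) (hN i j), h.integral_mul_eq_zero hX hη (hw i j) (hN i j), add_zero]
  have hm : Measurable fun A => matInner D A * whiten (designCov π) A i j := by
    simp only [matInner_eq_dotProduct]
    exact (measurable_dotProduct_vec _).mul (hw i j)
  rw [← integral_map (f := fun A => matInner D A * whiten (designCov π) A i j) hX.aemeasurable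
    hm.aestronglyMeasurable, hXπ, integral_inner_mul_whiten hπ2 hQ]

end OneSample

/-! ### The pilot estimator -/

lemma posSemidef_self_mul_transpose {m n : Type*} [Fintype m] [Fintype n] (N : Matrix m n ℝ) :
    (N * Nᵀ).PosSemidef := by
  rw [← conjTranspose_eq_transpose_of_trivial]
  exact posSemidef_self_mul_conjTranspose N

lemma posSemidef_transpose_mul_self {m n : Type*} [Fintype m] [Fintype n] (N : Matrix m n ℝ) :
    (Nᵀ * N).PosSemidef := by
  rw [← conjTranspose_eq_transpose_of_trivial]
  exact posSemidef_conjTranspose_mul_self N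

/-- The choice `ν = √(L / (w n))` balances the exponent `n ν² v / 2 - 2 L`, for the second-moment
bound `v = 2 w`, at `-L`. -/
lemma tuning_parameters {w L n : ℝ} (hw : 0 < w) (hL : 0 < L) (hn : 0 < n) :
    0 < √(L / (w * n)) ∧ n * (√(L / (w * n)) ^ 2 * (2 * w) / 2) - 2 * L = -L ∧
      2 * L / (n * √(L / (w * n))) = 2 * √(w * L / n) := by
  have hpos : 0 < √(L / (w * n)) := by positivity
  refine ⟨hpos, ?_, ?_⟩
  · rw [Real.sq_sqrt (by positivity)]
    field_simp
    ring
  · have h1 : (n * √(L / (w * n))) * √(w * L / n) = L := by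
      rw [mul_assoc, ← Real.sqrt_mul (by positivity)]
      have : L / (w * n) * (w * L / n) = (L / n) ^ 2 := by field_simp
      rw [this, Real.sqrt_sq (by positivity)]
      field_simp
    rw [div_eq_iff (by positivity)]
    linarith

end LowRankDesign

theorem mainTheorem1 {d₁ d₂ n₀ d : ℕ} (hd₁ : 0 < d₁) (hd₂ : 0 < d₂) (hn₀ : 0 < n₀)
    (hd : max d₁ d₂ ≤ d)
    -- the arm set and the sampling design
    (𝒜 : Set (Matrix (Fin d₁) (Fin d₂) ℝ))
    (π : Measure (Matrix (Fin d₁) (Fin d₂) ℝ)) [IsProbabilityMeasure π]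
    (hπ𝒜 : ∀ᵐ A ∂π, A ∈ 𝒜) (hπ2 : Integrable (fun A => ‖A‖ ^ 2) π)
    (hQ : IsUnit (LowRankDesign.designCov π))
    -- the unknown parameter, the input `Θ₀` and its error bound
    (Θstar Θ₀ : Matrix (Fin d₁) (Fin d₂) ℝ) (σ R₀ δ : ℝ) (hσ : 0 ≤ σ)
    (hR₀ : ∀ A ∈ 𝒜, |LowRankDesign.matInner (Θ₀ - Θstar) A| ≤ R₀)
    (hσR₀ : 0 < σ ^ 2 + R₀ ^ 2) (hδ₀ : 0 < δ) (hδ₁ : δ < 1)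
    -- the samples
    {Ω : Type*} [MeasurableSpace Ω] (μ : Measure Ω) [IsProbabilityMeasure μ]
    (X : Fin n₀ → Ω → Matrix (Fin d₁) (Fin d₂) ℝ) (η Y : Fin n₀ → Ω → ℝ)
    (hX : ∀ k, Measurable (X k)) (hη : ∀ k, Measurable (η k))
    (hXπ : ∀ k, μ.map (X k) = π)
    (hindep : iIndepFun (fun k ω => (X k ω, η k ω)) μ)
    (hsub : ∀ k, LowRankDesign.CondSubgaussian μ (η k) (X k) σ)
    (hY : ∀ k ω, Y k ω = LowRankDesign.matInner Θstar (X k ω) + η k ω) :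
    let Q := LowRankDesign.designCov π
    let M : Fin n₀ → Ω → Matrix (Fin d₁) (Fin d₂) ℝ :=
      fun k ω => LowRankDesign.oneSample Q Θ₀ (X k ω) (Y k ω)
    -- the error bound for the pilot estimator
    ENNReal.ofReal (1 - δ) ≤
        μ {ω | ‖LowRankDesign.pilot Q Θ₀ σ R₀ δ d (fun k => X k ω) (fun k => Y k ω) - Θstar‖ ≤
          2 * √((σ ^ 2 + R₀ ^ 2) * LowRankDesign.B Q * Real.log (2 * d / δ) / n₀)} ∧
      -- the bound for the matrix variance proxy
      (∀ k, Integrable (fun ω => M k ω * (M k ω)ᵀ) μ) ∧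
      (∀ k, Integrable (fun ω => (M k ω)ᵀ * M k ω) μ) ∧
      max (∑ k, ‖∫ ω, M k ω * (M k ω)ᵀ ∂μ‖) (∑ k, ‖∫ ω, (M k ω)ᵀ * M k ω ∂μ‖) ≤
        2 * n₀ * LowRankDesign.B Q * (σ ^ 2 + R₀ ^ 2) := by
  intro Q M
  have hQpd : Q.PosDef := LowRankDesign.posDef_designCov hπ2 hQ
  have hB : 0 < LowRankDesign.B Q := LowRankDesign.B_pos hd₁ hd₂ hQpd
  have hn : (0 : ℝ) < n₀ := Nat.cast_pos.2 hn₀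
  -- The residual `Y - ⟨Θ₀, X⟩` is `⟨Θ* - Θ₀, X⟩ + η`, whose first part is bounded by `R₀`.
  have hsub_inner : ∀ A, LowRankDesign.matInner (Θstar - Θ₀) A =
      LowRankDesign.matInner Θstar A - LowRankDesign.matInner Θ₀ A := fun A => by
    rw [LowRankDesign.matInner, transpose_sub, Matrix.sub_mul, trace_sub]
    rfl
  have hbias : ∀ᵐ A ∂π, |LowRankDesign.matInner (Θstar - Θ₀) A| ≤ R₀ := by
    filter_upwards [hπ𝒜] with A hA
    have h := hR₀ A hA
    rw [LowRankDesign.matInner, transpose_sub, Matrix.sub_mul, trace_sub] at h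
    rw [hsub_inner, abs_sub_comm]
    exact h
  have hcmeas : Measurable (LowRankDesign.matInner (Θstar - Θ₀)) := by
    have : LowRankDesign.matInner (Θstar - Θ₀) = fun A => (Θstar - Θ₀).vec ⬝ᵥ A.vec :=
      funext fun A => LowRankDesign.matInner_eq_dotProduct _ A
    rw [this]
    exact LowRankDesign.measurable_dotProduct_vec _
  have hM : ∀ k ω, M k ω = (LowRankDesign.matInner (Θstar - Θ₀) (X k ω) + η k ω) •
      LowRankDesign.whiten Q (X k ω) := fun k ω => by
    change LowRankDesign.oneSample Q Θ₀ (X k ω) (Y k ω) = _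
    rw [LowRankDesign.oneSample_eq_smul_whiten, hY, hsub_inner]
    congr 1
    ring
  have hw := LowRankDesign.measurable_whiten Q
  have hMM : ∀ k, (fun ω => M k ω * (M k ω)ᵀ) = fun ω =>
      (LowRankDesign.matInner (Θstar - Θ₀) (X k ω) + η k ω) ^ 2 •
        (LowRankDesign.whiten Q (X k ω) * (LowRankDesign.whiten Q (X k ω))ᵀ) := fun k => by
    funext ω
    rw [hM, transpose_smul, Matrix.smul_mul, Matrix.mul_smul, smul_smul, sq]
  have hMM' : ∀ k, (fun ω => (M k ω)ᵀ * M k ω) = fun ω =>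
      (LowRankDesign.matInner (Θstar - Θ₀) (X k ω) + η k ω) ^ 2 •
        ((LowRankDesign.whiten Q (X k ω))ᵀ * LowRankDesign.whiten Q (X k ω)) := fun k => by
    funext ω
    rw [hM, transpose_smul, Matrix.smul_mul, Matrix.mul_smul, smul_smul, sq]
  have hPmeas : Measurable fun A => LowRankDesign.whiten Q A * (LowRankDesign.whiten Q A)ᵀ :=
    (show Continuous fun N : Matrix (Fin d₁) (Fin d₂) ℝ => N * Nᵀ by fun_prop).measurable.comp hw
  have hPmeas' : Measurable fun A => (LowRankDesign.whiten Q A)ᵀ * LowRankDesign.whiten Q A :=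
    (show Continuous fun N : Matrix (Fin d₁) (Fin d₂) ℝ => Nᵀ * N by fun_prop).measurable.comp hw
  have hint : ∀ k, Integrable (fun ω => M k ω * (M k ω)ᵀ) μ := fun k => by
    rw [hMM]
    exact LowRankDesign.integrable_residual_sq_smul (hsub k) (hX k) (hη k) (hXπ k) hcmeas hbias
      hPmeas (LowRankDesign.integrable_whiten_mul_transpose hπ2 Q)
  have hint' : ∀ k, Integrable (fun ω => (M k ω)ᵀ * M k ω) μ := fun k => by
    rw [hMM']
    exact LowRankDesign.integrable_residual_sq_smul (hsub k) (hX k) (hη k) (hXπ k) hcmeas hbias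
      hPmeas' (LowRankDesign.integrable_transpose_whiten_mul hπ2 Q)
  set v : ℝ := 2 * (σ ^ 2 + R₀ ^ 2) * LowRankDesign.B Q with hv
  have hv0 : 0 < v := by positivity
  have hvar : ∀ k, (v • 1 - ∫ ω, M k ω * (M k ω)ᵀ ∂μ).PosSemidef := fun k => by
    rw [hMM]
    refine le_iff.1 (LowRankDesign.integral_residual_sq_smul_le (hsub k) (hX k) (hη k) (hXπ k)
      hcmeas hbias hPmeas (LowRankDesign.integrable_whiten_mul_transpose hπ2 Q)
      (fun A => LowRankDesign.posSemidef_self_mul_transpose _) ?_)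
    rw [LowRankDesign.integral_whiten_mul_transpose hπ2 hQ]
    exact LowRankDesign.sum_Dcol_le hQpd
  have hvar' : ∀ k, (v • 1 - ∫ ω, (M k ω)ᵀ * M k ω ∂μ).PosSemidef := fun k => by
    rw [hMM']
    refine le_iff.1 (LowRankDesign.integral_residual_sq_smul_le (hsub k) (hX k) (hη k) (hXπ k)
      hcmeas hbias hPmeas' (LowRankDesign.integrable_transpose_whiten_mul hπ2 Q)
      (fun A => LowRankDesign.posSemidef_transpose_mul_self _) ?_)
    rw [LowRankDesign.integral_transpose_whiten_mul hπ2 hQ]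
    exact LowRankDesign.sum_Drow_le hQpd
  refine ⟨?_, hint, hint', ?_⟩
  · -- At the level `2 L`, where `L = ln (2 d / δ)`, the tuning makes the exponent of the
    -- deviation inequality `L - 2 L`, and the dimension factor is `d₁ + d₂ ≤ 2 d`.
    have hmean : ∀ k, Integrable (M k) μ ∧ ∫ ω, M k ω ∂μ = Θstar - Θ₀ := fun k => by
      have h := LowRankDesign.integral_residual_smul_whiten (hsub k) (hX k) (hη k) (hXπ k) hπ2 hQ
        (Θstar - Θ₀)
      rw [show M k = fun ω => (LowRankDesign.matInner (Θstar - Θ₀) (X k ω) + η k ω) •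
        LowRankDesign.whiten Q (X k ω) from funext (hM k)]
      exact h
    have hf : Measurable fun p : Matrix (Fin d₁) (Fin d₂) ℝ × ℝ =>
        (LowRankDesign.matInner (Θstar - Θ₀) p.1 + p.2) • LowRankDesign.whiten Q p.1 := by
      have hc : Continuous fun p : ℝ × Matrix (Fin d₁) (Fin d₂) ℝ => p.1 • p.2 := by fun_prop
      exact hc.measurable.comp (((hcmeas.comp measurable_fst).add measurable_snd).prodMk
        (hw.comp measurable_fst))
    have hMf : M = fun k => (fun p : Matrix (Fin d₁) (Fin d₂) ℝ × ℝ =>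
        (LowRankDesign.matInner (Θstar - Θ₀) p.1 + p.2) • LowRankDesign.whiten Q p.1) ∘
          fun ω => (X k ω, η k ω) := by
      funext k ω
      exact hM k ω
    have hMmeas : ∀ k, Measurable (M k) := fun k => by
      rw [hMf]
      exact hf.comp ((hX k).prodMk (hη k))
    have hMindep : iIndepFun M μ := by
      rw [hMf]
      exact hindep.comp (fun _ p => (LowRankDesign.matInner (Θstar - Θ₀) p.1 + p.2) •
        LowRankDesign.whiten Q p.1) fun _ => hf
    have hd1 : (1 : ℝ) ≤ d := by
      have : 1 ≤ d := le_trans (le_trans hd₁ (le_max_left _ _)) hd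
      exact_mod_cast this
    have hratio : 1 < 2 * d / δ := by
      rw [one_lt_div hδ₀]
      linarith
    set L : ℝ := Real.log (2 * d / δ) with hL
    have hL0 : 0 < L := Real.log_pos hratio
    set w : ℝ := (σ ^ 2 + R₀ ^ 2) * LowRankDesign.B Q with hwdef
    have hw0 : 0 < w := by positivity
    set ν : ℝ := LowRankDesign.tuning Q σ R₀ δ d n₀ with hν
    obtain ⟨hν0, hexp, hradius⟩ := LowRankDesign.tuning_parameters hw0 hL0 hn
    change 0 < ν at hν0
    change n₀ * (ν ^ 2 * (2 * w) / 2) - 2 * L = -L at hexp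
    change 2 * L / (n₀ * ν) = 2 * √(w * L / n₀) at hradius
    have htail := LowRankDesign.measure_norm_robustMean_sub_gt_le hn₀ hMmeas hMindep
      (fun k => (hmean k).1) hint hint' (fun k => (hmean k).2) (fun k => le_iff.2 (hvar k))
      (fun k => le_iff.2 (hvar' k)) hν0 (c := 2 * L) (by positivity)
    have hbound : ((d₁ : ℝ) + d₂) * Real.exp (-L) ≤ δ := by
      have h1 : ((d₁ : ℝ) + d₂) ≤ 2 * d := by
        have h2 := le_trans (le_max_left d₁ d₂) hd
        have h3 := le_trans (le_max_right d₁ d₂) hd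
        have h4 : d₁ + d₂ ≤ 2 * d := by omega
        exact_mod_cast h4
      rw [Real.exp_neg, hL, Real.exp_log (by positivity), inv_div, mul_div_assoc', div_le_iff₀
        (by positivity), mul_comm δ]
      exact mul_le_mul_of_nonneg_right h1 hδ₀.le
    have hvw : v = 2 * w := by
      rw [hv, hwdef]
      ring
    rw [hvw, hexp, hradius] at htail
    have hpilot : ∀ ω, LowRankDesign.pilot Q Θ₀ σ R₀ δ d (fun k => X k ω) (fun k => Y k ω) -
        Θstar = LowRankDesign.robustMean ν (fun k => M k ω) - (Θstar - Θ₀) := fun ω => by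
      rw [LowRankDesign.pilot]
      abel
    have hcompl : {ω | ‖LowRankDesign.pilot Q Θ₀ σ R₀ δ d (fun k => X k ω) (fun k => Y k ω) -
        Θstar‖ ≤ 2 * √(w * L / n₀)}ᶜ =
          {ω | 2 * √(w * L / n₀) < ‖LowRankDesign.robustMean ν (fun k => M k ω) -
            (Θstar - Θ₀)‖} := by
      ext ω
      rw [Set.mem_compl_iff, Set.mem_ofPred_eq, Set.mem_ofPred_eq, hpilot, not_le]
    have hone := measure_union_le (μ := μ) {ω | ‖LowRankDesign.pilot Q Θ₀ σ R₀ δ d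
      (fun k => X k ω) (fun k => Y k ω) - Θstar‖ ≤ 2 * √(w * L / n₀)}
        {ω | ‖LowRankDesign.pilot Q Θ₀ σ R₀ δ d (fun k => X k ω) (fun k => Y k ω) -
          Θstar‖ ≤ 2 * √(w * L / n₀)}ᶜ
    rw [Set.union_compl_self, measure_univ, hcompl] at hone
    rw [ENNReal.ofReal_sub _ hδ₀.le, ENNReal.ofReal_one, tsub_le_iff_right]
    exact hone.trans (add_le_add_right (htail.trans (ENNReal.ofReal_le_ofReal hbound)) _)
  · have hnorm : ∀ k, ‖∫ ω, M k ω * (M k ω)ᵀ ∂μ‖ ≤ v := fun k =>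
      LowRankDesign.norm_le_of_posSemidef_of_le hv0.le
        (LowRankDesign.posSemidef_integral (hint k) fun ω =>
          LowRankDesign.posSemidef_self_mul_transpose _) (le_iff.2 (hvar k))
    have hnorm' : ∀ k, ‖∫ ω, (M k ω)ᵀ * M k ω ∂μ‖ ≤ v := fun k =>
      LowRankDesign.norm_le_of_posSemidef_of_le hv0.le
        (LowRankDesign.posSemidef_integral (hint' k) fun ω =>
          LowRankDesign.posSemidef_transpose_mul_self _) (le_iff.2 (hvar' k))
    have hconst : ∑ _k : Fin n₀, v = 2 * n₀ * LowRankDesign.B Q * (σ ^ 2 + R₀ ^ 2) := by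
      rw [Finset.sum_const, Finset.card_univ, Fintype.card_fin, nsmul_eq_mul, hv]
      ring
    rw [← hconst]
    exact max_le (Finset.sum_le_sum fun k _ => hnorm k) (Finset.sum_le_sum fun k _ => hnorm' k)
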